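/- Let $(M,g)$ be a smooth, compact, connected Riemannian manifold without boundary, of dimension $n$, let $\Psi:M\to\mathbb R$ be smooth, and let $d\mu=e^{-\Psi}dx$, where $dx$ is the Riemannian measure. Denote by $\nabla$ the Levi-Civita connection, by $\eta^*$ the vector field dual to a 1-form $\eta$, by $\cdot$ and $|\cdot|$ the inner products and norms induced by $g$ on tensors (2-forms carry the usual inner product of forms, $\beta\cdot\gamma=\frac12 g^{ik}g^{jl}\beta_{ij}\gamma_{kl}$), and by $\mathrm{Ricci}_g$ the Ricci tensor. For smooth functions $f$ and smooth 1-forms $\omega$ let $$\delta\omega=g^{ij}\nabla_i\omega_j,\qquad \delta_\Psi\omega=\delta\omega-d\Psi\cdot\omega,\qquad \Delta f=\delta(df),\qquad Lf=\Delta f-\nabla\Psi\cdot\nabla f .$$ For a smooth 2-form $\beta$ let $\delta_\Psi\beta$ be the smooth 1-form determined by $\int_M d\omega\cdot\beta\,d\mu=-\int_M\omega\cdot\delta_\Psi\beta\,d\mu$ for all smooth 1-forms $\omega$ (equivalently, in every chart domain, for all $\omega$ with compact support in that domain). Let $\overrightarrow L=d\,\delta_\Psi+\delta_\Psi\,d$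 be the weighted Hodge–de Rham operator on 1-forms. Then, for all smooth 1-forms $\alpha,\eta$ on $M$ and all $b\in\mathbb R$, $\delta_\Psi(d\eta)$ exists and is unique, so that $\overrightarrow L\eta$ is well defined, and at every point of $M$ (computed in any chart) $$L\frac{|\eta|^2}{2}-\eta\cdot\overrightarrow L\eta+2b\,\alpha\cdot d|\eta|^2+4b^2|\alpha|^2|\eta|^2=|\nabla\eta+2b\,\alpha\otimes\eta|^2+(\mathrm{Ricci}_g+\mathrm{Hess}\,\Psi)(\eta^*,\eta^*),$$ where $|\nabla\eta+2b\,\alpha\otimes\eta|$ is the norm of the 2-tensor $\nabla_i\eta_j+2b\,\alpha_i\eta_j$. -/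

import Mathlib

open scoped Manifold ContDiff

noncomputable section

namespace RefinedBLW

/-! ### Riemannian calculus in a coordinate domain

Throughout, `G y` is the matrix `(g_ij)` of the metric at the coordinate point `y`, a 1-form is
given by its components `θ y i`, and 2-forms and covariant 2-tensors by components `A y i j`. -/

variable {n : ℕ}

/-- The partial derivative `∂_i f` of a function of the coordinates. -/
def pd (i : Fin n) (f : EuclideanSpace ℝ (Fin n) → ℝ) (y : EuclideanSpace ℝ (Fin n)) : ℝ :=
  fderiv ℝ f y (EuclideanSpace.single i 1)

/-- The differential `df` of a function, `(df)_i = ∂_i f`. -/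
def dFun (f : EuclideanSpace ℝ (Fin n) → ℝ) (y : EuclideanSpace ℝ (Fin n)) (i : Fin n) : ℝ :=
  pd i f y

/-- The exterior derivative of a 1-form, `(dθ)_ij = ∂_i θ_j - ∂_j θ_i`. -/
def dForm (θ : EuclideanSpace ℝ (Fin n) → Fin n → ℝ) (y : EuclideanSpace ℝ (Fin n))
    (i j : Fin n) : ℝ :=
  pd i (fun z => θ z j) y - pd j (fun z => θ z i) y

/-- The entries `g^ij` of the inverse of the metric matrix. -/
def gInv (G : EuclideanSpace ℝ (Fin n) → Matrix (Fin n) (Fin n) ℝ)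
    (y : EuclideanSpace ℝ (Fin n)) (i j : Fin n) : ℝ :=
  (G y)⁻¹ i j

/-- The inner product of two covectors at `y`, `a · b = g^ij a_i b_j`. -/
def inner1 (G : EuclideanSpace ℝ (Fin n) → Matrix (Fin n) (Fin n) ℝ)
    (y : EuclideanSpace ℝ (Fin n)) (a b : Fin n → ℝ) : ℝ :=
  ∑ i, ∑ j, gInv G y i j * a i * b j

/-- The inner product of two covariant 2-tensors at `y`, `A · B = g^ik g^jl A_ij B_kl`. -/
def innerTensor (G : EuclideanSpace ℝ (Fin n) → Matrix (Fin n) (Fin n) ℝ)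
    (y : EuclideanSpace ℝ (Fin n)) (A B : Fin n → Fin n → ℝ) : ℝ :=
  ∑ i, ∑ j, ∑ k, ∑ l, gInv G y i k * gInv G y j l * A i j * B k l

/-- The inner product of two 2-forms at `y`; with the factor `1/2` the forms `e^i ∧ e^j`, `i < j`,
of an orthonormal coframe are orthonormal. -/
def innerForm2 (G : EuclideanSpace ℝ (Fin n) → Matrix (Fin n) (Fin n) ℝ)
    (y : EuclideanSpace ℝ (Fin n)) (A B : Fin n → Fin n → ℝ) : ℝ :=
  (1 / 2) * innerTensor G y A B

/-- The components `θ^i = g^ij θ_j` of the vector `θ*` dual to a covector at `y`. -/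
def sharp (G : EuclideanSpace ℝ (Fin n) → Matrix (Fin n) (Fin n) ℝ)
    (y : EuclideanSpace ℝ (Fin n)) (a : Fin n → ℝ) (i : Fin n) : ℝ :=
  ∑ j, gInv G y i j * a j

/-- The Christoffel symbol `Γ^k_ij` of the Levi-Civita connection. -/
def christoffel (G : EuclideanSpace ℝ (Fin n) → Matrix (Fin n) (Fin n) ℝ)
    (k i j : Fin n) (y : EuclideanSpace ℝ (Fin n)) : ℝ :=
  (1 / 2) * ∑ l, gInv G y k l *
    (pd i (fun z => G z j l) y + pd j (fun z => G z i l) y - pd l (fun z => G z i j) y)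

/-- The covariant derivative of a 1-form, `∇_i θ_j = ∂_i θ_j - Γ^p_ij θ_p`. -/
def covDeriv (G : EuclideanSpace ℝ (Fin n) → Matrix (Fin n) (Fin n) ℝ)
    (θ : EuclideanSpace ℝ (Fin n) → Fin n → ℝ) (y : EuclideanSpace ℝ (Fin n))
    (i j : Fin n) : ℝ :=
  pd i (fun z => θ z j) y - ∑ p, christoffel G p i j y * θ y p

/-- The Hessian of a function, `∇_i (df)_j`. -/
def hess (G : EuclideanSpace ℝ (Fin n) → Matrix (Fin n) (Fin n) ℝ)
    (f : EuclideanSpace ℝ (Fin n) → ℝ) (y : EuclideanSpace ℝ (Fin n)) (i j : Fin n) : ℝ :=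
  covDeriv G (dFun f) y i j

/-- The Ricci tensor
`R_jk = ∂_l Γ^l_jk - ∂_j Γ^l_lk + Γ^l_lp Γ^p_jk - Γ^l_jp Γ^p_lk` (summed over `l` and `p`). -/
def ricci (G : EuclideanSpace ℝ (Fin n) → Matrix (Fin n) (Fin n) ℝ)
    (y : EuclideanSpace ℝ (Fin n)) (j k : Fin n) : ℝ :=
  ∑ l, (pd l (christoffel G l j k) y - pd j (christoffel G l l k) y +
    ∑ p, (christoffel G l l p y * christoffel G p j k y -
      christoffel G l j p y * christoffel G p l k y))

/-- The Bakry-Emery tensor `Ricci + Hess Ψ`, evaluated on two vectors. -/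
def bakryEmery (G : EuclideanSpace ℝ (Fin n) → Matrix (Fin n) (Fin n) ℝ)
    (Ψ : EuclideanSpace ℝ (Fin n) → ℝ) (y : EuclideanSpace ℝ (Fin n)) (u v : Fin n → ℝ) : ℝ :=
  ∑ i, ∑ j, (ricci G y i j + hess G Ψ y i j) * u i * v j

/-- The divergence of a 1-form, `δ θ = g^ij ∇_i θ_j`. -/
def divForm (G : EuclideanSpace ℝ (Fin n) → Matrix (Fin n) (Fin n) ℝ)
    (θ : EuclideanSpace ℝ (Fin n) → Fin n → ℝ) (y : EuclideanSpace ℝ (Fin n)) : ℝ :=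
  ∑ i, ∑ j, gInv G y i j * covDeriv G θ y i j

/-- The weighted divergence of a 1-form, `δ_Ψ θ = δ θ - dΨ · θ`. -/
def wDivForm (G : EuclideanSpace ℝ (Fin n) → Matrix (Fin n) (Fin n) ℝ)
    (Ψ : EuclideanSpace ℝ (Fin n) → ℝ) (θ : EuclideanSpace ℝ (Fin n) → Fin n → ℝ)
    (y : EuclideanSpace ℝ (Fin n)) : ℝ :=
  divForm G θ y - inner1 G y (dFun Ψ y) (θ y)

/-- The Laplace-Beltrami operator `Δ f = δ (df)`. -/
def laplaceBeltrami (G : EuclideanSpace ℝ (Fin n) → Matrix (Fin n) (Fin n) ℝ)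
    (f : EuclideanSpace ℝ (Fin n) → ℝ) (y : EuclideanSpace ℝ (Fin n)) : ℝ :=
  divForm G (dFun f) y

/-- The Markov generator `L f = Δ f - ∇Ψ · ∇f`. -/
def generator (G : EuclideanSpace ℝ (Fin n) → Matrix (Fin n) (Fin n) ℝ)
    (Ψ f : EuclideanSpace ℝ (Fin n) → ℝ) (y : EuclideanSpace ℝ (Fin n)) : ℝ :=
  laplaceBeltrami G f y - inner1 G y (dFun Ψ y) (dFun f y)

/-- The density of the weighted measure `dμ = e^{-Ψ} dx` (with `dx` the Riemannian measure)
with respect to the Lebesgue measure of the coordinates. -/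
def density (G : EuclideanSpace ℝ (Fin n) → Matrix (Fin n) (Fin n) ℝ)
    (Ψ : EuclideanSpace ℝ (Fin n) → ℝ) (y : EuclideanSpace ℝ (Fin n)) : ℝ :=
  Real.exp (-Ψ y) * Real.sqrt (G y).det

/-- A smooth 1-form with compact support in the coordinate domain `U`. -/
structure IsTestForm (U : Set (EuclideanSpace ℝ (Fin n)))
    (θ : EuclideanSpace ℝ (Fin n) → Fin n → ℝ) : Prop where
  smooth : ∀ i, ContDiff ℝ ∞ (fun y => θ y i)
  compact_support : ∀ i, HasCompactSupport (fun y => θ y i)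
  support_subset : ∀ i, tsupport (fun y => θ y i) ⊆ U

/-- `ξ` is the weighted codifferential `δ_Ψ β` of the 2-form `β` on the coordinate domain `U`: it
is a smooth 1-form on `U`, and `δ_Ψ` is adjoint to `d` in `L²(μ)`, with the sign for which `δ_Ψ` is
a divergence (and not minus a divergence), as for `δ_Ψ` on 1-forms:
`∫ dθ · β dμ = - ∫ θ · ξ dμ` for all test forms `θ`. -/
structure IsWeightedCodifferential (U : Set (EuclideanSpace ℝ (Fin n)))
    (G : EuclideanSpace ℝ (Fin n) → Matrix (Fin n) (Fin n) ℝ)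
    (Ψ : EuclideanSpace ℝ (Fin n) → ℝ)
    (β : EuclideanSpace ℝ (Fin n) → Fin n → Fin n → ℝ)
    (ξ : EuclideanSpace ℝ (Fin n) → Fin n → ℝ) : Prop where
  smooth : ∀ i, ContDiffOn ℝ ∞ (fun y => ξ y i) U
  adjoint : ∀ θ : EuclideanSpace ℝ (Fin n) → Fin n → ℝ, IsTestForm U θ →
    (∫ y, innerForm2 G y (dForm θ y) (β y) * density G Ψ y) =
      -(∫ y, inner1 G y (θ y) (ξ y) * density G Ψ y)

open Classical in
/-- The weighted codifferential `δ_Ψ β` on `U` of a 2-form `β`: the 1-form characterised by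
`IsWeightedCodifferential` (and `0` if there were none). -/
def weightedCodifferential (U : Set (EuclideanSpace ℝ (Fin n)))
    (G : EuclideanSpace ℝ (Fin n) → Matrix (Fin n) (Fin n) ℝ)
    (Ψ : EuclideanSpace ℝ (Fin n) → ℝ)
    (β : EuclideanSpace ℝ (Fin n) → Fin n → Fin n → ℝ) :
    EuclideanSpace ℝ (Fin n) → Fin n → ℝ :=
  if h : ∃ ξ, IsWeightedCodifferential U G Ψ β ξ then h.choose else 0

/-- The weighted Hodge-de Rham operator on 1-forms, `d δ_Ψ + δ_Ψ d`. -/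
def hodgeDeRham (U : Set (EuclideanSpace ℝ (Fin n)))
    (G : EuclideanSpace ℝ (Fin n) → Matrix (Fin n) (Fin n) ℝ)
    (Ψ : EuclideanSpace ℝ (Fin n) → ℝ) (θ : EuclideanSpace ℝ (Fin n) → Fin n → ℝ)
    (y : EuclideanSpace ℝ (Fin n)) (i : Fin n) : ℝ :=
  dFun (wDivForm G Ψ θ) y i + weightedCodifferential U G Ψ (dForm θ) y i

/-! ### Reading the objects of a manifold in a chart -/

section Charts

variable {M : Type*} [TopologicalSpace M] [ChartedSpace (EuclideanSpace ℝ (Fin n)) M]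

/-- Smooth 1-forms on `M`: smooth sections of the cotangent bundle. -/
abbrev OneForm (n : ℕ) (M : Type*) [TopologicalSpace M]
    [ChartedSpace (EuclideanSpace ℝ (Fin n)) M] [IsManifold (𝓡 n) ∞ M] : Type _ :=
  ContMDiffSection (𝓡 n) (EuclideanSpace ℝ (Fin n) →L[ℝ] ℝ) ∞
    (fun x : M => TangentSpace (𝓡 n) x →L[ℝ] ℝ)

/-- Smooth Riemannian metrics on `M`. -/
abbrev SmoothMetric (n : ℕ) (M : Type*) [TopologicalSpace M]
    [ChartedSpace (EuclideanSpace ℝ (Fin n)) M] [IsManifold (𝓡 n) ∞ M] : Type _ :=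
  Bundle.ContMDiffRiemannianMetric (𝓡 n) ∞ (EuclideanSpace ℝ (Fin n))
    (fun x : M => TangentSpace (𝓡 n) x)

/-- The coordinate vector field `e_i` of the chart `c`, at the point with coordinates `y`. -/
def coordVec (c : OpenPartialHomeomorph M (EuclideanSpace ℝ (Fin n)))
    (y : EuclideanSpace ℝ (Fin n)) (i : Fin n) : TangentSpace (𝓡 n) (c.symm y) :=
  mfderiv (𝓡 n) (𝓡 n) c.symm y (EuclideanSpace.single i (1 : ℝ) : EuclideanSpace ℝ (Fin n))

/-- The matrix `g_ij = g(e_i, e_j)` of the metric in the chart `c`. -/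
def metricInChart [IsManifold (𝓡 n) ∞ M] (g : SmoothMetric n M)
    (c : OpenPartialHomeomorph M (EuclideanSpace ℝ (Fin n)))
    (y : EuclideanSpace ℝ (Fin n)) : Matrix (Fin n) (Fin n) ℝ :=
  Matrix.of fun i j => g.inner (c.symm y) (coordVec c y i) (coordVec c y j)

/-- The components `θ_i = θ(e_i)` of a 1-form in the chart `c`. -/
def formInChart [IsManifold (𝓡 n) ∞ M] (θ : OneForm n M)
    (c : OpenPartialHomeomorph M (EuclideanSpace ℝ (Fin n)))
    (y : EuclideanSpace ℝ (Fin n)) (i : Fin n) : ℝ :=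
  θ (c.symm y) (coordVec c y i)

/-- A function on `M`, read in the chart `c`. -/
def funInChart (f : M → ℝ) (c : OpenPartialHomeomorph M (EuclideanSpace ℝ (Fin n)))
    (y : EuclideanSpace ℝ (Fin n)) : ℝ :=
  f (c.symm y)

end Charts

end RefinedBLW

end

open scoped Manifold ContDiff

noncomputable section

namespace RefinedBLW

/-! The identity is a weighted Bochner formula followed by completing a square. In a chart,
`L(|η|²/2)` is `|∇η|²` plus the pairing of `η*` with the rough Laplacian `g^ik ∇_i ∇_k η_m`, plus a
first-order term in `dΨ`. Expanding `d δ_Ψ η` and `δ_Ψ d η` by covariant derivatives and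
subtracting, the rough Laplacians cancel, and so do all products of `dΨ` with `∇η`. What survives is
`Hess Ψ`, from differentiating `dΨ · η`, and the commutator `g^ik (∇_i ∇_m - ∇_m ∇_i) η_k`, which is
the Ricci term. This is `bochner`; its main inputs are `laplaceBeltrami_half_normSq`,
`dFun_wDivForm`, `codiffVec_dForm` and `sum_commutator`.

Since `δ_Ψ` on 2-forms is defined only by duality, it must first be computed. Integration by parts
shows that the explicit divergence `codiff` is adjoint to `d`, and the fundamental lemma of the
calculus of variations gives uniqueness on the chart domain; the chosen codifferential therefore
equals `codiff` there.

The shift is algebra: `α · d|η|² = 2 ⟨α ⊗ η, ∇η⟩` and `|α ⊗ η|² = |α|² |η|²`, so the terms in `b`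
are exactly those in the expansion of `|∇η + 2b α ⊗ η|²`. -/

theorem map_toLp_eq_sum {n : ℕ} {F : Type*} [AddCommGroup F] [Module ℝ F] [TopologicalSpace F]
    (T : EuclideanSpace ℝ (Fin n) →L[ℝ] F) (x : Fin n → ℝ) :
    T (WithLp.toLp 2 x) = ∑ i, x i • T (EuclideanSpace.single i 1) := by
  rw [← Finset.sum_congr rfl fun i _ => map_smul T (x i) _, ← map_sum]
  congr 1
  ext i
  simp [Finset.sum_apply, Pi.single_apply]

/-! ### Smoothness and positivity of the chart expressions. -/

section Charts
variable {n : ℕ} {M : Type*} [TopologicalSpace M] [ChartedSpace (EuclideanSpace ℝ (Fin n)) M]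
  [IsManifold (𝓡 n) ∞ M] {c : OpenPartialHomeomorph M (EuclideanSpace ℝ (Fin n))}

/-- The field is the tangent map of `c.symm` applied to a constant vector field on the model space.
Smoothness of the components of metrics and forms follows by evaluating smooth bundle maps on such
fields. -/
theorem contMDiffOn_coordVec (hc : c ∈ IsManifold.maximalAtlas (𝓡 n) ∞ M) (i : Fin n) :
    ContMDiffOn (𝓡 n) (𝓡 n).tangent ∞
      (fun y => Bundle.TotalSpace.mk' (EuclideanSpace ℝ (Fin n)) (E := fun x : M => TangentSpace (𝓡 n) x)
        (c.symm y) (coordVec c y i)) c.target := by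
  have h1 := (contMDiffOn_symm_of_mem_maximalAtlas hc).contMDiffOn_tangentMapWithin
    (m := ∞) (by simp) c.open_target.uniqueMDiffOn
  have h2 : ContMDiff (𝓡 n) (𝓡 n).tangent ∞ (fun y : EuclideanSpace ℝ (Fin n) =>
      (⟨y, EuclideanSpace.single i (1 : ℝ)⟩ : TangentBundle (𝓡 n) (EuclideanSpace ℝ (Fin n)))) := by
    exact (contMDiff_vectorSpace_iff_contDiff (V := fun _ => EuclideanSpace.single i (1 : ℝ))).2
      contDiff_const
  refine (h1.comp h2.contMDiffOn (fun y hy => hy)).congr fun y hy => ?_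
  simp [tangentMapWithin, coordVec, mfderivWithin_of_isOpen c.open_target hy]

theorem contDiffOn_metricInChart (g : SmoothMetric n M)
    (hc : c ∈ IsManifold.maximalAtlas (𝓡 n) ∞ M) (i j : Fin n) :
    ContDiffOn ℝ ∞ (fun y => metricInChart g c y i j) c.target := by
  rw [← contMDiffOn_iff_contDiffOn]
  have hg := g.contMDiff.comp_contMDiffOn (contMDiffOn_symm_of_mem_maximalAtlas hc)
  have := ContMDiffOn.clm_bundle_apply₂ (b := fun y => c.symm y) (E₃ := Bundle.Trivial M ℝ) 
    hg (contMDiffOn_coordVec hc i) (contMDiffOn_coordVec hc j)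
  intro y hy
  have := this y hy
  simp only [Bundle.contMDiffWithinAt_totalSpace] at this
  exact this.2

theorem contDiffOn_formInChart (θ : OneForm n M)
    (hc : c ∈ IsManifold.maximalAtlas (𝓡 n) ∞ M) (i : Fin n) :
    ContDiffOn ℝ ∞ (fun y => formInChart θ c y i) c.target := by
  rw [← contMDiffOn_iff_contDiffOn]
  have hg := θ.contMDiff.comp_contMDiffOn (contMDiffOn_symm_of_mem_maximalAtlas hc)
  have := ContMDiffOn.clm_bundle_apply (b := fun y => c.symm y) (E₂ := Bundle.Trivial M ℝ) 
    hg (contMDiffOn_coordVec hc i)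
  intro y hy
  have := this y hy
  simp only [Bundle.contMDiffWithinAt_totalSpace] at this
  exact this.2

omit [IsManifold (𝓡 n) ∞ M] in
theorem contDiffOn_funInChart {f : M → ℝ} (hf : ContMDiff (𝓡 n) 𝓘(ℝ) ∞ f)
    (hc : c ∈ IsManifold.maximalAtlas (𝓡 n) ∞ M) :
    ContDiffOn ℝ ∞ (funInChart f c) c.target := by
  rw [← contMDiffOn_iff_contDiffOn]
  exact hf.comp_contMDiffOn (contMDiffOn_symm_of_mem_maximalAtlas hc)

theorem posDef_metricInChart (g : SmoothMetric n M)
    (hc : c ∈ IsManifold.maximalAtlas (𝓡 n) ∞ M) {y : EuclideanSpace ℝ (Fin n)}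
    (hy : y ∈ c.target) : (metricInChart g c y).PosDef := by
  have hs : MDifferentiableAt (𝓡 n) (𝓡 n) c.symm y :=
    (contMDiffOn_symm_of_mem_maximalAtlas hc).contMDiffAt (c.open_target.mem_nhds hy)
      |>.mdifferentiableAt (by simp)
  have hc' : MDifferentiableAt (𝓡 n) (𝓡 n) c (c.symm y) :=
    (contMDiffOn_of_mem_maximalAtlas hc).contMDiffAt
      (c.open_source.mem_nhds (c.map_target hy)) |>.mdifferentiableAt (by simp)
  -- The differential of `c` is a left inverse, since `c ∘ c.symm` is the identity near `y`. Nonzero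
  -- coordinate vectors thus give nonzero tangent vectors, on which the metric is positive.
  have hinj : Function.Injective (mfderiv (𝓡 n) (𝓡 n) c.symm y) := by
    have h1 : mfderiv (𝓡 n) (𝓡 n) (c ∘ c.symm) y = ContinuousLinearMap.id ℝ _ := by
      rw [← mfderiv_id (I := 𝓡 n) (x := y)]
      refine Filter.EventuallyEq.mfderiv_eq ?_
      filter_upwards [c.open_target.mem_nhds hy] with z hz
      exact c.right_inv hz
    rw [mfderiv_comp y hc' hs] at h1
    exact Function.LeftInverse.injective (g := mfderiv (𝓡 n) (𝓡 n) c (c.symm y))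
      fun v => DFunLike.congr_fun h1 v
  have hsum (x : Fin n → ℝ) : mfderiv (𝓡 n) (𝓡 n) c.symm y (WithLp.toLp 2 x) =
      ∑ i, x i • coordVec c y i := 
    map_toLp_eq_sum (mfderiv (𝓡 n) (𝓡 n) c.symm y) x
  refine Matrix.PosDef.of_dotProduct_mulVec_pos ?_ fun x hx => ?_
  · ext i j
    simpa [metricInChart] using g.symm _ _ _
  · have := g.pos (c.symm y) (mfderiv (𝓡 n) (𝓡 n) c.symm y (WithLp.toLp 2 x)) fun h => hx (by
      have := hinj (h.trans (map_zero _).symm)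
      exact (WithLp.toLp_eq_zero 2).1 this)
    rw [hsum] at this
    simp only [metricInChart, dotProduct, Matrix.mulVec, Finset.mul_sum, map_sum, map_smul,
      sum_apply, smul_apply, smul_eq_mul, Matrix.of_apply, star_trivial] at this ⊢
    refine this.trans_eq (Finset.sum_congr rfl fun i _ => Finset.sum_congr rfl fun j _ => ?_)
    rw [g.symm _ (coordVec c y i)]
    ring

end Charts

/-! ### Partial derivatives and the Levi-Civita calculus on an open set. -/

section LocalCalculus
variable {n : ℕ} {U : Set (EuclideanSpace ℝ (Fin n))} {y : EuclideanSpace ℝ (Fin n)}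
  {f f₁ f₂ : EuclideanSpace ℝ (Fin n) → ℝ}

theorem pd_congr (hU : IsOpen U) (h : Set.EqOn f₁ f₂ U) (hy : y ∈ U) (i : Fin n) :
    pd i f₁ y = pd i f₂ y := by
  unfold pd
  rw [(h.eventuallyEq_of_mem (hU.mem_nhds hy)).fderiv_eq]

theorem pd_sub (i : Fin n) (h₁ : DifferentiableAt ℝ f₁ y) (h₂ : DifferentiableAt ℝ f₂ y) :
    pd i (fun z => f₁ z - f₂ z) y = pd i f₁ y - pd i f₂ y := by
  simp [pd, fderiv_fun_sub h₁ h₂]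

theorem pd_neg (i : Fin n) : pd i (fun z => -f z) y = -pd i f y := by
  simp [pd, fderiv_fun_neg]

theorem pd_mul (i : Fin n) (h₁ : DifferentiableAt ℝ f₁ y) (h₂ : DifferentiableAt ℝ f₂ y) :
    pd i (fun z => f₁ z * f₂ z) y = pd i f₁ y * f₂ y + f₁ y * pd i f₂ y := by
  simp [pd, fderiv_fun_mul h₁ h₂]
  ring

theorem pd_const (i : Fin n) (a : ℝ) : pd i (fun _ => a) y = 0 := by
  simp [pd]

theorem pd_const_mul (i : Fin n) (a : ℝ) (h : DifferentiableAt ℝ f y) :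
    pd i (fun z => a * f z) y = a * pd i f y := by
  simp [pd_mul i (differentiableAt_const a) h, pd_const]

theorem pd_sum {ι : Type*} (s : Finset ι) (i : Fin n) {F : ι → EuclideanSpace ℝ (Fin n) → ℝ}
    (h : ∀ j ∈ s, DifferentiableAt ℝ (F j) y) :
    pd i (fun z => ∑ j ∈ s, F j z) y = ∑ j ∈ s, pd i (F j) y := by
  simp [pd, fderiv_fun_sum h]

theorem contDiffOn_pd (hU : IsOpen U) (hf : ContDiffOn ℝ ∞ f U) (i : Fin n) :
    ContDiffOn ℝ ∞ (pd i f) U :=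
  (hf.fderiv_of_isOpen hU (by simp)).clm_apply contDiffOn_const

theorem differentiableAt_of_contDiffOn (hU : IsOpen U) (hf : ContDiffOn ℝ ∞ f U) (hy : y ∈ U) :
    DifferentiableAt ℝ f y :=
  (hf.contDiffAt (hU.mem_nhds hy)).differentiableAt (by simp)

theorem pd_comm (hU : IsOpen U) (hf : ContDiffOn ℝ ∞ f U) (hy : y ∈ U) (i j : Fin n) :
    pd i (pd j f) y = pd j (pd i f) y := by
  have h := hf.contDiffAt (hU.mem_nhds hy)
  have hd : DifferentiableAt ℝ (fderiv ℝ f) y :=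
    (h.fderiv_right (m := ∞) (by simp)).differentiableAt (by simp)
  have key (a b : Fin n) : pd a (pd b f) y =
      fderiv ℝ (fderiv ℝ f) y (EuclideanSpace.single a 1) (EuclideanSpace.single b 1) := by
    unfold pd
    rw [fderiv_clm_apply hd (differentiableAt_const _)]
    simp
  rw [key, key]
  exact h.isSymmSndFDerivAt (by simpa using WithTop.coe_le_coe.2 (le_top (a := (2 : ℕ∞)))) _ _

/-- The matrix of a smooth Riemannian metric on the open set `U`. -/
structure IsLocalMetric (U : Set (EuclideanSpace ℝ (Fin n)))
    (G : EuclideanSpace ℝ (Fin n) → Matrix (Fin n) (Fin n) ℝ) : Prop where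
  isOpen : IsOpen U
  smooth : ∀ i j, ContDiffOn ℝ ∞ (fun y => G y i j) U
  posDef : ∀ y ∈ U, (G y).PosDef

variable {G : EuclideanSpace ℝ (Fin n) → Matrix (Fin n) (Fin n) ℝ}

theorem contDiffOn_det {m : ℕ} {A : EuclideanSpace ℝ (Fin n) → Matrix (Fin m) (Fin m) ℝ}
    (hA : ∀ i j, ContDiffOn ℝ ∞ (fun y => A y i j) U) :
    ContDiffOn ℝ ∞ (fun y => (A y).det) U := by
  simp only [Matrix.det_apply]
  exact ContDiffOn.sum fun σ _ => (contDiffOn_prod fun i _ => hA _ _).const_smul _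

/-- Jacobi's formula for the derivative of a determinant. -/
theorem pd_det (hG : ∀ i j, DifferentiableAt ℝ (fun z => G z i j) y) (i : Fin n) :
    pd i (fun z => (G z).det) y =
      ∑ j, ∑ k, (G y).adjugate j k * pd i (fun z => G z k j) y := by
  -- Laplace expansion, in the form of Cramer's rule: each inner sum is the determinant with column
  -- `j` differentiated. The Leibniz formula produces the same determinants.
  have h1 : ∀ j, ∑ k, (G y).adjugate j k * pd i (fun z => G z k j) y =
      ((G y).updateCol j (fun k => pd i (fun z => G z k j) y)).det := fun j => by
    rw [← Matrix.cramer_apply, Matrix.cramer_eq_adjugate_mulVec]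
    rfl
  simp only [h1, Matrix.det_apply]
  have hp (σ : Equiv.Perm (Fin n)) :
      DifferentiableAt ℝ (fun z => ∏ k, G z (σ k) k) y :=
    (HasFDerivAt.finsetProd fun k _ => (hG (σ k) k).hasFDerivAt).differentiableAt
  rw [pd_sum _ _ fun σ _ => (hp σ).fun_const_smul _,
    Finset.sum_comm]
  refine Finset.sum_congr rfl fun σ _ => ?_
  rw [← Finset.smul_sum]
  simp only [pd]
  rw [fderiv_fun_const_smul (hp σ),
    fderiv_finsetProd fun k _ => hG _ _]
  simp only [smul_apply, sum_apply]
  congr 1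
  refine Finset.sum_congr rfl fun k _ => ?_
  rw [← Finset.mul_prod_erase _ _ (Finset.mem_univ k), Matrix.updateCol_self, smul_eq_mul, mul_comm]
  congr 1
  refine Finset.prod_congr rfl fun l hl => ?_
  rw [Matrix.updateCol_ne (Finset.ne_of_mem_erase hl)]

/-- The covariant derivative of a covariant 2-tensor, `∇_k T_ij`. -/
def covDeriv₂ (G : EuclideanSpace ℝ (Fin n) → Matrix (Fin n) (Fin n) ℝ)
    (T : EuclideanSpace ℝ (Fin n) → Fin n → Fin n → ℝ) (y : EuclideanSpace ℝ (Fin n))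
    (k i j : Fin n) : ℝ :=
  pd k (fun z => T z i j) y - ∑ p, christoffel G p k i y * T y p j -
    ∑ p, christoffel G p k j y * T y i p

namespace IsLocalMetric

variable (hG : IsLocalMetric U G)
include hG

theorem differentiableAt (hy : y ∈ U) (i j : Fin n) : DifferentiableAt ℝ (fun z => G z i j) y :=
  differentiableAt_of_contDiffOn hG.isOpen (hG.smooth i j) hy

theorem symm (hy : y ∈ U) (i j : Fin n) : G y i j = G y j i := by
  simpa using (hG.posDef y hy).isHermitian.apply j i

theorem isUnit_det (hy : y ∈ U) : IsUnit (G y).det := (hG.posDef y hy).det_pos.ne'.isUnit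

theorem gInv_symm (hy : y ∈ U) (i j : Fin n) : gInv G y i j = gInv G y j i := by
  simpa [gInv] using (hG.posDef y hy).isHermitian.inv.apply j i

/-- Cramer's rule writes the inverse as a quotient of determinants, with denominator positive on
`U`. -/
theorem contDiffOn_gInv (i j : Fin n) : ContDiffOn ℝ ∞ (fun y => gInv G y i j) U := by
  simp only [gInv, Matrix.inv_def, Ring.inverse_eq_inv', Matrix.smul_apply, smul_eq_mul,
    Matrix.adjugate_apply]
  refine (((contDiffOn_det hG.smooth).inv fun y hy => (hG.posDef y hy).det_pos.ne').mul
    (contDiffOn_det fun k l => ?_))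
  simp only [Matrix.updateRow_apply]
  split_ifs
  · exact contDiffOn_const
  · exact hG.smooth k l

theorem differentiableAt_gInv (hy : y ∈ U) (i j : Fin n) :
    DifferentiableAt ℝ (fun z => gInv G z i j) y :=
  differentiableAt_of_contDiffOn hG.isOpen (hG.contDiffOn_gInv i j) hy

theorem contDiffOn_christoffel (k i j : Fin n) : ContDiffOn ℝ ∞ (christoffel G k i j) U := by
  unfold christoffel
  exact contDiffOn_const.mul (ContDiffOn.sum fun l _ => (hG.contDiffOn_gInv k l).mul
    (((contDiffOn_pd hG.isOpen (hG.smooth _ _) _).add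
      (contDiffOn_pd hG.isOpen (hG.smooth _ _) _)).sub
      (contDiffOn_pd hG.isOpen (hG.smooth _ _) _)))

theorem differentiableAt_christoffel (hy : y ∈ U) (k i j : Fin n) :
    DifferentiableAt ℝ (christoffel G k i j) y :=
  differentiableAt_of_contDiffOn hG.isOpen (hG.contDiffOn_christoffel k i j) hy

theorem pd_symm (hy : y ∈ U) (k i j : Fin n) :
    pd k (fun z => G z i j) y = pd k (fun z => G z j i) y :=
  pd_congr hG.isOpen (fun _ hz => hG.symm hz i j) hy k

theorem christoffel_symm (hy : y ∈ U) (k i j : Fin n) :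
    christoffel G k i j y = christoffel G k j i y := by
  unfold christoffel
  refine congrArg _ (Finset.sum_congr rfl fun l _ => ?_)
  rw [hG.pd_symm hy l i j, hG.pd_symm hy i j l, hG.pd_symm hy j i l, hG.pd_symm hy i l j,
    hG.pd_symm hy j l i]
  ring

/-- Metric compatibility, `∇ g⁻¹ = 0`. Differentiating `G⁻¹ G = 1` gives `∂G⁻¹ = -G⁻¹ (∂G) G⁻¹`; in
the sum of the two Christoffel terms only `∂_i g` survives, the other derivatives cancelling in
pairs. -/
theorem pd_gInv (hy : y ∈ U) (i j k : Fin n) :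
    pd i (fun z => gInv G z j k) y =
      -(∑ p, christoffel G j i p y * gInv G y p k) - ∑ p, christoffel G k i p y * gInv G y j p := by
  have h1 : (Matrix.of fun a b => pd i (fun z => gInv G z a b) y) * G y +
      (G y)⁻¹ * (Matrix.of fun a b => pd i (fun z => G z a b) y) = 0 := by
    ext a b
    have h2 : pd i (fun z => ∑ c, gInv G z a c * G z c b) y = 0 := by
      rw [pd_congr hG.isOpen (f₂ := fun _ => (1 : Matrix (Fin n) (Fin n) ℝ) a b) _ hy, pd_const]
      intro _ hz
      rw [← Matrix.nonsing_inv_mul _ (hG.isUnit_det hz)]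
      rfl
    rw [pd_sum _ _ fun c _ => (hG.differentiableAt_gInv hy _ _).fun_mul (hG.differentiableAt hy _ _)]
      at h2
    rw [Finset.sum_congr rfl fun c _ => pd_mul i (hG.differentiableAt_gInv hy a c)
      (hG.differentiableAt hy c b), Finset.sum_add_distrib] at h2
    exact h2
  have h3 : (Matrix.of fun a b => pd i (fun z => gInv G z a b) y) =
      -((G y)⁻¹ * (Matrix.of fun a b => pd i (fun z => G z a b) y) * (G y)⁻¹) := by
    rw [← Matrix.neg_mul, ← eq_neg_of_add_eq_zero_left h1, Matrix.mul_assoc,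
      Matrix.mul_nonsing_inv _ (hG.isUnit_det hy), Matrix.mul_one]
  have h4 : pd i (fun z => gInv G z j k) y =
      -∑ p, (∑ l, gInv G y j l * pd i (fun z => G z l p) y) * gInv G y p k :=
    congrFun (congrFun h3 j) k
  have h5 : ∑ p, christoffel G k i p y * gInv G y j p = ∑ p, ∑ l, (1 / 2) * gInv G y k p *
      (pd i (fun z => G z l p) y + pd l (fun z => G z i p) y - pd p (fun z => G z i l) y) *
        gInv G y j l := by
    rw [Finset.sum_comm]
    simp only [christoffel, Finset.mul_sum, Finset.sum_mul, mul_assoc]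
  rw [h4, h5]
  simp only [christoffel, Finset.mul_sum, Finset.sum_mul, ← Finset.sum_neg_distrib,
    ← Finset.sum_sub_distrib]
  refine Finset.sum_congr rfl fun p _ => Finset.sum_congr rfl fun l _ => ?_
  rw [hG.pd_symm hy i p l, hG.gInv_symm hy k p]
  ring

/-- In the trace `Γ^p_pi` the two terms not differentiated along `i` cancel by symmetry, leaving
half of `g^pl ∂_i g_lp`; Jacobi's formula does the rest. -/
theorem pd_det_eq (hy : y ∈ U) (i : Fin n) :
    pd i (fun z => (G z).det) y = 2 * (G y).det * ∑ p, christoffel G p p i y := by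
  have h0 := hG.isUnit_det hy
  have hadj : ∀ j k, (G y).adjugate j k = (G y).det * gInv G y j k := fun j k => by
    simp [gInv, Matrix.inv_def, h0.ne_zero]
  have h1 : ∑ p, christoffel G p p i y =
      (1 / 2) * ∑ p, ∑ l, gInv G y p l * pd i (fun z => G z l p) y := by
    have h2 : ∑ p, ∑ l, gInv G y p l * pd p (fun z => G z i l) y =
        ∑ p, ∑ l, gInv G y p l * pd l (fun z => G z p i) y := by
      rw [Finset.sum_comm]
      refine Finset.sum_congr rfl fun p _ => Finset.sum_congr rfl fun l _ => ?_
      rw [hG.gInv_symm hy, hG.pd_symm hy l i p]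
    simp only [christoffel, ← Finset.mul_sum, mul_sub, mul_add, Finset.sum_sub_distrib,
      Finset.sum_add_distrib, h2, hG.pd_symm hy i]
    ring
  rw [pd_det (hG.differentiableAt hy), h1]
  simp only [hadj, mul_assoc, ← Finset.mul_sum]
  ring

theorem density_pos {Ψ : EuclideanSpace ℝ (Fin n) → ℝ} (hy : y ∈ U) : 0 < density G Ψ y :=
  mul_pos (Real.exp_pos _) (Real.sqrt_pos.2 (hG.posDef y hy).det_pos)

theorem contDiffOn_density {Ψ : EuclideanSpace ℝ (Fin n) → ℝ} (hΨ : ContDiffOn ℝ ∞ Ψ U) :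
    ContDiffOn ℝ ∞ (density G Ψ) U :=
  hΨ.neg.exp.mul ((contDiffOn_det hG.smooth).sqrt fun y hy => (hG.posDef y hy).det_pos.ne')

/-- This logarithmic derivative is what turns a coordinate divergence against `μ` into a covariant
one with a `-dΨ` correction. -/
theorem pd_density {Ψ : EuclideanSpace ℝ (Fin n) → ℝ} (hΨ : ContDiffOn ℝ ∞ Ψ U) (hy : y ∈ U)
    (i : Fin n) :
    pd i (density G Ψ) y = density G Ψ y * (∑ p, christoffel G p p i y - pd i Ψ y) := by
  have hd := (hG.posDef y hy).det_pos
  have h1 := differentiableAt_of_contDiffOn hG.isOpen hΨ hy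
  have h2 := differentiableAt_of_contDiffOn hG.isOpen (contDiffOn_det hG.smooth) hy
  have e1 : pd i (fun z => Real.exp (-Ψ z)) y = -(Real.exp (-Ψ y) * pd i Ψ y) := by
    simp [pd, fderiv_exp h1.fun_neg, fderiv_fun_neg]
  have e2 : pd i (fun z => Real.sqrt (G z).det) y =
      Real.sqrt (G y).det * ∑ p, christoffel G p p i y := by
    have : pd i (fun z => Real.sqrt (G z).det) y =
        1 / (2 * Real.sqrt (G y).det) * pd i (fun z => (G z).det) y := by
      simp [pd, fderiv_sqrt h2 hd.ne']
    rw [this, hG.pd_det_eq hy]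
    have := Real.sqrt_pos.2 hd
    field_simp
    rw [Real.sq_sqrt hd.le]
  unfold density
  rw [pd_mul i h1.fun_neg.exp (h2.sqrt hd.ne'), e1, e2]
  ring

/-- Traces commute with `∇`: by `pd_gInv`, the derivative of `g^ij` supplies exactly the two
Christoffel corrections. It serves for `T = u ⊗ v` (product rule for inner products) and for `T =
∇θ` (derivative of the divergence). -/
theorem pd_trace {T : EuclideanSpace ℝ (Fin n) → Fin n → Fin n → ℝ} (hy : y ∈ U)
    (hT : ∀ i j, DifferentiableAt ℝ (fun z => T z i j) y) (k : Fin n) :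
    pd k (fun z => ∑ i, ∑ j, gInv G z i j * T z i j) y =
      ∑ i, ∑ j, gInv G y i j * covDeriv₂ G T y k i j := by
  rw [pd_sum _ _ fun i _ => DifferentiableAt.fun_sum fun j _ =>
    (hG.differentiableAt_gInv hy i j).fun_mul (hT i j)]
  have h1 : ∑ i, ∑ j, (∑ p, christoffel G i k p y * gInv G y p j) * T y i j =
      ∑ i, ∑ j, gInv G y i j * ∑ p, christoffel G p k i y * T y p j := by
    rw [Finset.sum_comm]
    conv_rhs => rw [Finset.sum_comm]
    refine Finset.sum_congr rfl fun j _ => ?_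
    simp only [Finset.sum_mul, Finset.mul_sum]
    rw [Finset.sum_comm]
    exact Finset.sum_congr rfl fun i _ => Finset.sum_congr rfl fun p _ => by ring
  have h2 : ∑ i, ∑ j, (∑ p, christoffel G j k p y * gInv G y i p) * T y i j =
      ∑ i, ∑ j, gInv G y i j * ∑ p, christoffel G p k j y * T y i p := by
    refine Finset.sum_congr rfl fun j _ => ?_
    simp only [Finset.sum_mul, Finset.mul_sum]
    rw [Finset.sum_comm]
    exact Finset.sum_congr rfl fun i _ => Finset.sum_congr rfl fun p _ => by ring
  have h3 : ∀ i j, pd k (fun z => gInv G z i j * T z i j) y = gInv G y i j * pd k (fun z => T z i j) y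
      - (∑ p, christoffel G i k p y * gInv G y p j) * T y i j -
      (∑ p, christoffel G j k p y * gInv G y i p) * T y i j := fun i j => by
    rw [pd_mul k (hG.differentiableAt_gInv hy i j) (hT i j), hG.pd_gInv hy]
    ring
  have h4 : ∀ i, pd k (fun z => ∑ j, gInv G z i j * T z i j) y =
      ∑ j, pd k (fun z => gInv G z i j * T z i j) y := fun i =>
    pd_sum _ _ fun j _ => (hG.differentiableAt_gInv hy i j).fun_mul (hT i j)
  simp only [h4, h3, covDeriv₂, mul_sub, Finset.sum_sub_distrib, h1, h2]

end IsLocalMetric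
end LocalCalculus

/-! ### The weighted codifferential of 2-forms: explicit formula, adjointness, uniqueness. -/

section Codifferential
variable {n : ℕ} {U : Set (EuclideanSpace ℝ (Fin n))} {y : EuclideanSpace ℝ (Fin n)}
  {G : EuclideanSpace ℝ (Fin n) → Matrix (Fin n) (Fin n) ℝ}
  {Ψ : EuclideanSpace ℝ (Fin n) → ℝ}
  {β : EuclideanSpace ℝ (Fin n) → Fin n → Fin n → ℝ}

/-- The contravariant components `A^ij` of a covariant 2-tensor. -/
def raise (G : EuclideanSpace ℝ (Fin n) → Matrix (Fin n) (Fin n) ℝ)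
    (A : EuclideanSpace ℝ (Fin n) → Fin n → Fin n → ℝ) (y : EuclideanSpace ℝ (Fin n))
    (i j : Fin n) : ℝ :=
  ∑ k, gInv G y i k * ∑ l, gInv G y j l * A y k l

/-- The contravariant components of the weighted codifferential of a 2-form,
`e^Ψ (det g)^(-1/2) ∂_i (e^(-Ψ) (det g)^(1/2) β^ij)`. -/
def codiffVec (G : EuclideanSpace ℝ (Fin n) → Matrix (Fin n) (Fin n) ℝ)
    (Ψ : EuclideanSpace ℝ (Fin n) → ℝ)
    (β : EuclideanSpace ℝ (Fin n) → Fin n → Fin n → ℝ) (y : EuclideanSpace ℝ (Fin n))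
    (j : Fin n) : ℝ :=
  (density G Ψ y)⁻¹ * ∑ i, pd i (fun z => density G Ψ z * raise G β z i j) y

/-- The covariant components of the weighted codifferential of a 2-form. -/
def codiff (G : EuclideanSpace ℝ (Fin n) → Matrix (Fin n) (Fin n) ℝ)
    (Ψ : EuclideanSpace ℝ (Fin n) → ℝ)
    (β : EuclideanSpace ℝ (Fin n) → Fin n → Fin n → ℝ) (y : EuclideanSpace ℝ (Fin n))
    (l : Fin n) : ℝ :=
  ∑ j, G y l j * codiffVec G Ψ β y j

theorem raise_antisymm (hβ : ∀ i j, β y i j = -β y j i) (i j : Fin n) :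
    raise G β y i j = -raise G β y j i := by
  simp only [raise, Finset.mul_sum, ← Finset.sum_neg_distrib]
  rw [Finset.sum_comm]
  refine Finset.sum_congr rfl fun k _ => Finset.sum_congr rfl fun l _ => ?_
  rw [hβ l k]
  ring

theorem innerTensor_eq_sum_raise (A : Fin n → Fin n → ℝ) :
    innerTensor G y A (β y) = ∑ i, ∑ j, A i j * raise G β y i j := by
  simp only [innerTensor, raise, Finset.mul_sum]
  exact Finset.sum_congr rfl fun i _ => Finset.sum_congr rfl fun j _ =>
    Finset.sum_congr rfl fun k _ => Finset.sum_congr rfl fun l _ => by ring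

/-- Both halves of `dθ` contribute equally against an antisymmetric tensor, which absorbs the factor
`1/2`. -/
theorem innerForm2_dForm (hβ : ∀ i j, β y i j = -β y j i)
    (θ : EuclideanSpace ℝ (Fin n) → Fin n → ℝ) :
    innerForm2 G y (dForm θ y) (β y) =
      ∑ i, ∑ j, pd i (fun z => θ z j) y * raise G β y i j := by
  have h : ∑ i, ∑ j, pd j (fun z => θ z i) y * raise G β y i j =
      -∑ i, ∑ j, pd i (fun z => θ z j) y * raise G β y i j := by
    rw [Finset.sum_comm]
    simp only [← Finset.sum_neg_distrib]
    refine Finset.sum_congr rfl fun i _ => Finset.sum_congr rfl fun j _ => ?_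
    rw [raise_antisymm hβ j i]
    ring
  simp only [innerForm2, innerTensor_eq_sum_raise, dForm, sub_mul, Finset.sum_sub_distrib, h]
  ring

theorem dForm_antisymm (θ : EuclideanSpace ℝ (Fin n) → Fin n → ℝ) (i j : Fin n) :
    dForm θ y i j = -dForm θ y j i := by
  simp [dForm]

theorem pd_eq_zero_of_notMem_tsupport {f : EuclideanSpace ℝ (Fin n) → ℝ} (hy : y ∉ tsupport f)
    (i : Fin n) : pd i f y = 0 := by
  simp [pd, fderiv_of_notMem_tsupport (𝕜 := ℝ) hy]

theorem integrable_mul_of_tsupport_subset {u φ : EuclideanSpace ℝ (Fin n) → ℝ}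
    (hU : IsOpen U) (hu : ContinuousOn u U) (hφ : Continuous φ) (hc : HasCompactSupport φ)
    (hs : tsupport φ ⊆ U) : MeasureTheory.Integrable (fun y => u y * φ y) := by
  have hcont : Continuous fun y => u y * φ y := by
    refine continuous_of_tsupport fun x hx => ?_
    exact (hu.continuousAt (hU.mem_nhds (hs (tsupport_mul_subset_right hx)))).mul hφ.continuousAt
  exact hcont.integrable_of_hasCompactSupport hc.mul_left

/-- The weight is controlled only on `U`, but every product is continuous on the whole space because
the support of `φ` lies in `U`. The integrability statements are kept for splitting integrals of
finite sums. -/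
theorem integral_pd_mul {w φ : EuclideanSpace ℝ (Fin n) → ℝ} (hU : IsOpen U)
    (hw : ContDiffOn ℝ ∞ w U) (hφ : ContDiff ℝ ∞ φ) (hc : HasCompactSupport φ)
    (hs : tsupport φ ⊆ U) (i : Fin n) :
    MeasureTheory.Integrable (fun y => pd i φ y * w y) ∧
    MeasureTheory.Integrable (fun y => φ y * pd i w y) ∧
    ∫ y, pd i φ y * w y = -∫ y, φ y * pd i w y := by
  have hsub : tsupport (pd i φ) ⊆ tsupport φ :=
    closure_minimal (fun x hx => by_contra fun h => hx (pd_eq_zero_of_notMem_tsupport h i))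
      (isClosed_tsupport _)
  have hpφ : Continuous (pd i φ) :=
    ((hφ.continuous_fderiv (by simp)).clm_apply continuous_const)
  have hcp : HasCompactSupport (pd i φ) := hc.of_isClosed_subset (isClosed_tsupport _) hsub
  have h1 := integrable_mul_of_tsupport_subset hU hw.continuousOn hpφ hcp (hsub.trans hs)
  have h2 := integrable_mul_of_tsupport_subset hU (contDiffOn_pd hU hw i).continuousOn
    hφ.continuous hc hs
  have h3 := integrable_mul_of_tsupport_subset hU hw.continuousOn hφ.continuous hc hs
  refine ⟨by simpa only [mul_comm] using h1, by simpa only [mul_comm] using h2, ?_⟩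
  have := integral_mul_fderiv_eq_neg_fderiv_mul_of_integrable
    (v := EuclideanSpace.single i (1 : ℝ)) h2 h1 h3
    (fun x hx => differentiableAt_of_contDiffOn hU hw (hs hx))
    (fun x _ => hφ.differentiable (by simp) x)
  simpa only [mul_comm, pd] using this

namespace IsLocalMetric

variable (hG : IsLocalMetric U G)
include hG

theorem contDiffOn_raise (hβ : ∀ i j, ContDiffOn ℝ ∞ (fun y => β y i j) U) (i j : Fin n) :
    ContDiffOn ℝ ∞ (fun y => raise G β y i j) U :=
  ContDiffOn.sum fun k _ => (hG.contDiffOn_gInv i k).mul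
    (ContDiffOn.sum fun l _ => (hG.contDiffOn_gInv j l).mul (hβ k l))

theorem contDiffOn_density_mul_raise (hΨ : ContDiffOn ℝ ∞ Ψ U)
    (hβ : ∀ i j, ContDiffOn ℝ ∞ (fun y => β y i j) U) (i j : Fin n) :
    ContDiffOn ℝ ∞ (fun y => density G Ψ y * raise G β y i j) U :=
  (hG.contDiffOn_density hΨ).mul (hG.contDiffOn_raise hβ i j)

theorem contDiffOn_codiff (hΨ : ContDiffOn ℝ ∞ Ψ U)
    (hβ : ∀ i j, ContDiffOn ℝ ∞ (fun y => β y i j) U) (l : Fin n) :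
    ContDiffOn ℝ ∞ (fun y => codiff G Ψ β y l) U :=
  ContDiffOn.sum fun j _ => (hG.smooth l j).mul
    (((hG.contDiffOn_density hΨ).inv fun _ hy => (hG.density_pos hy).ne').mul
      (ContDiffOn.sum fun i _ => contDiffOn_pd hG.isOpen
        (hG.contDiffOn_density_mul_raise hΨ hβ i j) i))

theorem sum_gInv_mul_sum (hy : y ∈ U) (v : Fin n → ℝ) (i : Fin n) :
    ∑ l, gInv G y i l * ∑ j, G y l j * v j = v i := by
  have h : (G y)⁻¹.mulVec ((G y).mulVec v) i = v i := by
    rw [Matrix.mulVec_mulVec, Matrix.nonsing_inv_mul _ (hG.isUnit_det hy), Matrix.one_mulVec]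
  exact h

theorem eq_zero_of_sum_gInv_mul (hy : y ∈ U) {v : Fin n → ℝ}
    (hv : ∀ i, ∑ j, gInv G y i j * v j = 0) : v = 0 := by
  have h : (G y)⁻¹.mulVec v = 0 := funext hv
  rw [← Matrix.one_mulVec v, ← Matrix.mul_nonsing_inv _ (hG.isUnit_det hy),
    ← Matrix.mulVec_mulVec, h, Matrix.mulVec_zero]

theorem inner1_codiff (hy : y ∈ U) (a : Fin n → ℝ) :
    inner1 G y a (codiff G Ψ β y) = ∑ j, a j * codiffVec G Ψ β y j := by
  unfold inner1
  refine Finset.sum_congr rfl fun i _ => ?_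
  rw [← hG.sum_gInv_mul_sum hy (codiffVec G Ψ β y) i, Finset.mul_sum]
  exact Finset.sum_congr rfl fun j _ => by unfold codiff; ring

theorem isWeightedCodifferential_codiff (hΨ : ContDiffOn ℝ ∞ Ψ U)
    (hβ : ∀ i j, ContDiffOn ℝ ∞ (fun y => β y i j) U) (hanti : ∀ y i j, β y i j = -β y j i) :
    IsWeightedCodifferential U G Ψ β (codiff G Ψ β) where
  smooth := hG.contDiffOn_codiff hΨ hβ
  adjoint θ hθ := by
    have ibp (i j : Fin n) := integral_pd_mul hG.isOpen
      (hG.contDiffOn_density_mul_raise hΨ hβ i j) (hθ.smooth j) (hθ.compact_support j)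
      (hθ.support_subset j) i
    have hl : ∀ y, innerForm2 G y (dForm θ y) (β y) * density G Ψ y =
        ∑ i, ∑ j, pd i (fun z => θ z j) y * (density G Ψ y * raise G β y i j) := fun y => by
      rw [innerForm2_dForm (hanti y)]
      simp only [Finset.sum_mul]
      exact Finset.sum_congr rfl fun i _ => Finset.sum_congr rfl fun j _ => by ring
    have hr : ∀ y, inner1 G y (θ y) (codiff G Ψ β y) * density G Ψ y =
        ∑ i, ∑ j, θ y j * pd i (fun z => density G Ψ z * raise G β z i j) y := fun y => by
      by_cases hy : y ∈ U
      · rw [hG.inner1_codiff hy, Finset.sum_comm, Finset.sum_mul]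
        refine Finset.sum_congr rfl fun j _ => ?_
        have := hG.density_pos (Ψ := Ψ) hy
        rw [codiffVec, ← Finset.mul_sum]
        field_simp
      -- Off `U` the matrix need not be invertible, but the test form vanishes there.
      · have h0 (j : Fin n) : θ y j = 0 :=
          image_eq_zero_of_notMem_tsupport (f := fun y => θ y j)
            fun h => hy (hθ.support_subset j h)
        simp [inner1, h0]
    simp only [hl, hr]
    rw [MeasureTheory.integral_finsetSum _ fun i _ =>
        MeasureTheory.integrable_finsetSum _ fun j _ => (ibp i j).1,
      MeasureTheory.integral_finsetSum _ fun i _ =>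
        MeasureTheory.integrable_finsetSum _ fun j _ => (ibp i j).2.1, ← Finset.sum_neg_distrib]
    refine Finset.sum_congr rfl fun i _ => ?_
    rw [MeasureTheory.integral_finsetSum _ fun j _ => (ibp i j).1,
      MeasureTheory.integral_finsetSum _ fun j _ => (ibp i j).2.1, ← Finset.sum_neg_distrib]
    exact Finset.sum_congr rfl fun j _ => (ibp i j).2.2

/-- Testing against forms with one nonzero component shows that the raised components of `ξ - ξ'`,
times the density, integrate to zero against every bump function. They vanish almost everywhere on
`U`, then everywhere by continuity, and both the density and `g⁻¹` can be cancelled. -/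
theorem eqOn_of_isWeightedCodifferential (hΨ : ContDiffOn ℝ ∞ Ψ U)
    {ξ ξ' : EuclideanSpace ℝ (Fin n) → Fin n → ℝ}
    (h : IsWeightedCodifferential U G Ψ β ξ) (h' : IsWeightedCodifferential U G Ψ β ξ') :
    Set.EqOn ξ ξ' U := by
  have hcont {ζ : EuclideanSpace ℝ (Fin n) → Fin n → ℝ}
      (hζ : ∀ i, ContDiffOn ℝ ∞ (fun y => ζ y i) U) (k : Fin n) :
      ContinuousOn (fun y => (∑ j, gInv G y k j * ζ y j) * density G Ψ y) U :=
    ((ContDiffOn.sum fun j _ => (hG.contDiffOn_gInv k j).mul (hζ j)).mul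
      (hG.contDiffOn_density hΨ)).continuousOn
  have key (k : Fin n) : Set.EqOn
      (fun y => (∑ j, gInv G y k j * ξ y j) * density G Ψ y -
        (∑ j, gInv G y k j * ξ' y j) * density G Ψ y) 0 U := by
    have hc := (hcont h.smooth k).sub (hcont h'.smooth k)
    have hae := hG.isOpen.ae_eq_zero_of_integral_contDiff_smul_eq_zero
      (hc.locallyIntegrableOn hG.isOpen.measurableSet (μ := MeasureTheory.volume)) fun φ hφ hφc hφs => by
      have htest : IsTestForm U fun y => Pi.single k (φ y) := by
        have hj (j : Fin n) : (fun y => (Pi.single k (φ y) : Fin n → ℝ) j) = φ ∨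
            (fun y => (Pi.single k (φ y) : Fin n → ℝ) j) = 0 := by
          rcases eq_or_ne j k with rfl | hjk
          · left; ext y; simp
          · right; ext y; simp [hjk]
        refine ⟨fun j => ?_, fun j => ?_, fun j => ?_⟩ <;> rcases hj j with e | e <;> rw [e]
        · exact hφ
        · exact contDiff_const
        · exact hφc
        · exact HasCompactSupport.zero
        · exact hφs
        · simp
      have hint {ζ : EuclideanSpace ℝ (Fin n) → Fin n → ℝ} (y : EuclideanSpace ℝ (Fin n)) :
          inner1 G y (Pi.single k (φ y)) (ζ y) * density G Ψ y =
            (∑ j, gInv G y k j * ζ y j) * density G Ψ y * φ y := by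
        rw [inner1, Finset.sum_eq_single k (fun i _ hi => by simp [hi]) (by simp)]
        simp only [Pi.single_eq_same, Finset.sum_mul]
        exact Finset.sum_congr rfl fun j _ => by ring
      have e := neg_injective ((h.adjoint _ htest).symm.trans (h'.adjoint _ htest))
      simp only [hint] at e
      rw [← sub_eq_zero, ← MeasureTheory.integral_sub
        (integrable_mul_of_tsupport_subset hG.isOpen (hcont h.smooth k) hφ.continuous hφc hφs)
        (integrable_mul_of_tsupport_subset hG.isOpen (hcont h'.smooth k) hφ.continuous hφc hφs)]
        at e
      rw [← e]
      exact MeasureTheory.integral_congr_ae (Filter.Eventually.of_forall fun y => by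
        simp only [smul_eq_mul, Pi.sub_apply]; ring)
    refine MeasureTheory.Measure.eqOn_open_of_ae_eq (μ := MeasureTheory.volume) ?_ hG.isOpen hc
      continuousOn_const
    exact (MeasureTheory.ae_restrict_iff' hG.isOpen.measurableSet).2 hae
  intro y hy
  refine sub_eq_zero.1 (hG.eq_zero_of_sum_gInv_mul hy fun k => ?_)
  have := key k hy
  simp only [← sub_mul, Pi.zero_apply, mul_eq_zero, (hG.density_pos hy).ne', or_false] at this
  simpa [mul_sub] using this

theorem isWeightedCodifferential_weightedCodifferential (hΨ : ContDiffOn ℝ ∞ Ψ U)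
    (hβ : ∀ i j, ContDiffOn ℝ ∞ (fun y => β y i j) U) (hanti : ∀ y i j, β y i j = -β y j i) :
    IsWeightedCodifferential U G Ψ β (weightedCodifferential U G Ψ β) := by
  have h : ∃ ξ, IsWeightedCodifferential U G Ψ β ξ :=
    ⟨_, hG.isWeightedCodifferential_codiff hΨ hβ hanti⟩
  rw [weightedCodifferential, dif_pos h]
  exact h.choose_spec

end IsLocalMetric
end Codifferential

/-! ### Tensor algebra, raising indices, and curvature. -/

section Bochner
variable {n : ℕ} {U : Set (EuclideanSpace ℝ (Fin n))} {y : EuclideanSpace ℝ (Fin n)}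
  {G : EuclideanSpace ℝ (Fin n) → Matrix (Fin n) (Fin n) ℝ}
  {Ψ : EuclideanSpace ℝ (Fin n) → ℝ}
  {u v θ : EuclideanSpace ℝ (Fin n) → Fin n → ℝ}
  {T : EuclideanSpace ℝ (Fin n) → Fin n → Fin n → ℝ}

/-- The components `R^q_kim` of the Riemann curvature tensor. -/
def riemann (G : EuclideanSpace ℝ (Fin n) → Matrix (Fin n) (Fin n) ℝ)
    (y : EuclideanSpace ℝ (Fin n)) (q k i m : Fin n) : ℝ :=
  pd i (christoffel G q m k) y - pd m (christoffel G q i k) y +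
    ∑ p, (christoffel G q i p y * christoffel G p m k y -
      christoffel G q m p y * christoffel G p i k y)

theorem ricci_eq_sum_riemann (j k : Fin n) : ricci G y j k = ∑ l, riemann G y l k l j := rfl

theorem inner1_eq_sum_mul_sharp (a b : Fin n → ℝ) :
    inner1 G y a b = ∑ i, a i * sharp G y b i := by
  simp only [inner1, sharp, Finset.mul_sum]
  exact Finset.sum_congr rfl fun i _ => Finset.sum_congr rfl fun j _ => by ring

theorem innerTensor_add_add (A B : Fin n → Fin n → ℝ) :
    innerTensor G y (fun i j => A i j + B i j) (fun i j => A i j + B i j) =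
      innerTensor G y A A + innerTensor G y A B + innerTensor G y B A + innerTensor G y B B := by
  simp only [innerTensor, ← Finset.sum_add_distrib]
  exact Finset.sum_congr rfl fun i _ => Finset.sum_congr rfl fun j _ =>
    Finset.sum_congr rfl fun k _ => Finset.sum_congr rfl fun l _ => by ring

theorem innerTensor_smul_left (t : ℝ) (A B : Fin n → Fin n → ℝ) :
    innerTensor G y (fun i j => t * A i j) B = t * innerTensor G y A B := by
  simp only [innerTensor, Finset.mul_sum]
  exact Finset.sum_congr rfl fun i _ => Finset.sum_congr rfl fun j _ =>
    Finset.sum_congr rfl fun k _ => Finset.sum_congr rfl fun l _ => by ring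

theorem innerTensor_tmul_left (a b : Fin n → ℝ) (A : Fin n → Fin n → ℝ) :
    innerTensor G y (fun i j => a i * b j) A =
      ∑ i, ∑ k, gInv G y i k * a i * ∑ l, A k l * ∑ j, gInv G y j l * b j := by
  simp only [innerTensor, Finset.mul_sum]
  refine Finset.sum_congr rfl fun i _ => ?_
  rw [Finset.sum_comm]
  refine Finset.sum_congr rfl fun k _ => ?_
  rw [Finset.sum_comm]
  exact Finset.sum_congr rfl fun l _ => Finset.sum_congr rfl fun j _ => by ring

namespace IsLocalMetric

variable (hG : IsLocalMetric U G)
include hG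

theorem inner1_comm (hy : y ∈ U) (a b : Fin n → ℝ) : inner1 G y a b = inner1 G y b a := by
  unfold inner1
  rw [Finset.sum_comm]
  refine Finset.sum_congr rfl fun i _ => Finset.sum_congr rfl fun j _ => ?_
  rw [hG.gInv_symm hy]
  ring

theorem inner1_eq_sum_sharp_mul (hy : y ∈ U) (a b : Fin n → ℝ) :
    inner1 G y a b = ∑ i, sharp G y a i * b i := by
  rw [hG.inner1_comm hy, inner1_eq_sum_mul_sharp]
  exact Finset.sum_congr rfl fun i _ => mul_comm _ _

theorem innerTensor_comm (hy : y ∈ U) (A B : Fin n → Fin n → ℝ) :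
    innerTensor G y A B = innerTensor G y B A := by
  simp only [innerTensor]
  have h (F : Fin n → Fin n → Fin n → Fin n → ℝ) :
      ∑ i, ∑ j, ∑ k, ∑ l, F i j k l = ∑ k, ∑ l, ∑ i, ∑ j, F i j k l := by
    have : ∑ p : Fin n × Fin n, ∑ q : Fin n × Fin n, F p.1 p.2 q.1 q.2 =
        ∑ q : Fin n × Fin n, ∑ p : Fin n × Fin n, F p.1 p.2 q.1 q.2 := Finset.sum_comm
    simpa only [Fintype.sum_prod_type] using this
  rw [h]
  refine Finset.sum_congr rfl fun i _ => Finset.sum_congr rfl fun j _ =>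
    Finset.sum_congr rfl fun k _ => Finset.sum_congr rfl fun l _ => ?_
  rw [hG.gInv_symm hy k i, hG.gInv_symm hy l j]
  ring

theorem innerTensor_tmul (hy : y ∈ U) (a b : Fin n → ℝ) (A : Fin n → Fin n → ℝ) :
    innerTensor G y (fun i j => a i * b j) A =
      inner1 G y a (fun k => ∑ l, A k l * sharp G y b l) := by
  rw [innerTensor_tmul_left]
  simp only [inner1, sharp]
  refine Finset.sum_congr rfl fun i _ => Finset.sum_congr rfl fun k _ => ?_
  refine congrArg _ (Finset.sum_congr rfl fun l _ => congrArg _ (Finset.sum_congr rfl fun j _ => ?_))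
  rw [hG.gInv_symm hy]

theorem differentiableAt_sum_mul (hy : y ∈ U) (i : Fin n)
    (hu : ∀ i, DifferentiableAt ℝ (fun z => u z i) y) :
    DifferentiableAt ℝ (fun z => ∑ k, gInv G z i k * u z k) y :=
  DifferentiableAt.fun_sum fun k _ => (hG.differentiableAt_gInv hy i k).fun_mul (hu k)

/-- Raising an index commutes with `∇`: this is `∂_i u^a = (∇_i u)^a - Γ^a_ip u^p`. -/
theorem pd_sharp (hy : y ∈ U) (hu : ∀ i, DifferentiableAt ℝ (fun z => u z i) y) (i a : Fin n) :
    pd i (fun z => ∑ k, gInv G z a k * u z k) y =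
      ∑ k, gInv G y a k * (pd i (fun z => u z k) y - ∑ p, christoffel G p i k y * u y p) -
        ∑ p, christoffel G a i p y * ∑ k, gInv G y p k * u y k := by
  rw [pd_sum _ _ fun k _ => (hG.differentiableAt_gInv hy a k).fun_mul (hu k)]
  simp only [pd_mul i (hG.differentiableAt_gInv hy a _) (hu _), hG.pd_gInv hy, sub_mul, neg_mul,
    mul_sub, Finset.sum_add_distrib, Finset.sum_sub_distrib, Finset.sum_neg_distrib]
  have h1 : ∑ k, (∑ p, christoffel G a i p y * gInv G y p k) * u y k =
      ∑ p, christoffel G a i p y * ∑ k, gInv G y p k * u y k := by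
    simp only [Finset.sum_mul, Finset.mul_sum]
    rw [Finset.sum_comm]
    exact Finset.sum_congr rfl fun _ _ => Finset.sum_congr rfl fun _ _ => by ring
  have h2 : ∑ k, (∑ p, christoffel G k i p y * gInv G y a p) * u y k =
      ∑ k, gInv G y a k * ∑ p, christoffel G p i k y * u y p := by
    simp only [Finset.sum_mul, Finset.mul_sum]
    rw [Finset.sum_comm]
    exact Finset.sum_congr rfl fun _ _ => Finset.sum_congr rfl fun _ _ => by ring
  rw [h1, h2]
  ring

theorem pd_raise (hy : y ∈ U) (hT : ∀ i j, DifferentiableAt ℝ (fun z => T z i j) y)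
    (i a b : Fin n) :
    pd i (fun z => raise G T z a b) y = raise G (fun z k l => covDeriv₂ G T z i k l) y a b -
      ∑ p, christoffel G a i p y * raise G T y p b -
      ∑ p, christoffel G b i p y * raise G T y a p := by
  unfold raise
  rw [hG.pd_sharp hy (u := fun z k => ∑ l, gInv G z b l * T z k l)
    fun k => hG.differentiableAt_sum_mul hy b (u := fun z => T z k) (hT k)]
  have h : ∀ k, pd i (fun z => ∑ l, gInv G z b l * T z k l) y =
      ∑ l, gInv G y b l * (pd i (fun z => T z k l) y - ∑ p, christoffel G p i l y * T y k p) -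
        ∑ p, christoffel G b i p y * ∑ l, gInv G y p l * T y k l := fun k =>
    hG.pd_sharp hy (u := fun z => T z k) (hT k) i b
  have h1 : ∑ p, christoffel G b i p y * ∑ k, gInv G y a k * ∑ l, gInv G y p l * T y k l =
      ∑ k, gInv G y a k * ∑ p, christoffel G b i p y * ∑ l, gInv G y p l * T y k l := by
    simp only [Finset.mul_sum]
    rw [Finset.sum_comm]
    exact Finset.sum_congr rfl fun _ _ => Finset.sum_congr rfl fun _ _ =>
      Finset.sum_congr rfl fun _ _ => by ring
  have h2 : ∀ k, ∑ l, gInv G y b l * ∑ p, christoffel G p i k y * T y p l =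
      ∑ p, christoffel G p i k y * ∑ l, gInv G y b l * T y p l := fun k => by
    simp only [Finset.mul_sum]
    rw [Finset.sum_comm]
    exact Finset.sum_congr rfl fun _ _ => Finset.sum_congr rfl fun _ _ => by ring
  simp only [h, h1, covDeriv₂, mul_sub, Finset.sum_sub_distrib, h2]
  ring

/-- The trace `Γ^p_pi` from the density cancels the Christoffel correction on the contracted index.
The correction on the free index pairs a symmetric `Γ^j_ip` with an antisymmetric tensor and
vanishes. -/
theorem codiffVec_eq (hΨ : ContDiffOn ℝ ∞ Ψ U) (hy : y ∈ U)
    (hT : ∀ i j, ContDiffOn ℝ ∞ (fun y => T y i j) U) (hanti : ∀ y i j, T y i j = -T y j i)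
    (j : Fin n) :
    codiffVec G Ψ T y j = ∑ i, ∑ k, gInv G y i k * ∑ m, gInv G y j m *
      (covDeriv₂ G T y i k m - pd i Ψ y * T y k m) := by
  have hd := hG.density_pos (Ψ := Ψ) hy
  have h1 : ∀ i, pd i (fun z => density G Ψ z * raise G T z i j) y = density G Ψ y *
      ((∑ p, christoffel G p p i y - pd i Ψ y) * raise G T y i j +
        (raise G (fun z k l => covDeriv₂ G T z i k l) y i j -
      ∑ p, christoffel G i i p y * raise G T y p j -
      ∑ p, christoffel G j i p y * raise G T y i p)) := fun i => by
    rw [pd_mul i (differentiableAt_of_contDiffOn hG.isOpen (hG.contDiffOn_density hΨ) hy)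
      (differentiableAt_of_contDiffOn hG.isOpen (hG.contDiffOn_raise hT i j) hy),
      show pd i (fun z => density G Ψ z) y = _ from hG.pd_density hΨ hy i,
      hG.pd_raise hy fun i j => differentiableAt_of_contDiffOn hG.isOpen (hT i j) hy]
    ring
  have h2 : ∑ i, ∑ p, christoffel G j i p y * raise G T y i p = 0 := by
    have : ∑ i, ∑ p, christoffel G j i p y * raise G T y i p =
        -∑ i, ∑ p, christoffel G j i p y * raise G T y i p := by
      conv_lhs => rw [Finset.sum_comm]
      simp only [← Finset.sum_neg_distrib]
      refine Finset.sum_congr rfl fun i _ => Finset.sum_congr rfl fun p _ => ?_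
      rw [raise_antisymm (hanti y), hG.christoffel_symm hy]
      ring
    linarith
  have h3 : ∑ i, ∑ p, christoffel G i i p y * raise G T y p j =
      ∑ i, (∑ p, christoffel G p p i y) * raise G T y i j := by
    rw [Finset.sum_comm]
    simp only [Finset.sum_mul]
  rw [codiffVec, Finset.sum_congr rfl fun i _ => h1 i, ← Finset.mul_sum, inv_mul_cancel_left₀ hd.ne']
  simp only [sub_mul, Finset.sum_add_distrib, Finset.sum_sub_distrib, h2, h3]
  simp only [raise, mul_sub, Finset.sum_sub_distrib, Finset.mul_sum]
  have h4 : ∑ i, ∑ k, ∑ l, pd i Ψ y * (gInv G y i k * (gInv G y j l * T y k l)) =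
      ∑ i, ∑ k, ∑ l, gInv G y i k * (gInv G y j l * (pd i Ψ y * T y k l)) :=
    Finset.sum_congr rfl fun _ _ => Finset.sum_congr rfl fun _ _ =>
      Finset.sum_congr rfl fun _ _ => by ring
  rw [h4]
  ring

theorem contDiffOn_covDeriv (hθ : ∀ i, ContDiffOn ℝ ∞ (fun y => θ y i) U) (i j : Fin n) :
    ContDiffOn ℝ ∞ (fun y => covDeriv G θ y i j) U :=
  (contDiffOn_pd hG.isOpen (hθ j) i).sub
    (ContDiffOn.sum fun p _ => (hG.contDiffOn_christoffel p i j).mul (hθ p))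

/-- The Ricci identity for 1-forms. -/
theorem covDeriv₂_covDeriv_sub (hθ : ∀ i, ContDiffOn ℝ ∞ (fun y => θ y i) U) (hy : y ∈ U)
    (i m k : Fin n) :
    covDeriv₂ G (covDeriv G θ) y i m k - covDeriv₂ G (covDeriv G θ) y m i k =
      -∑ q, riemann G y q k i m * θ y q := by
  have hd := fun p => differentiableAt_of_contDiffOn hG.isOpen (hθ p) hy
  have h (a b : Fin n) : pd a (fun z => covDeriv G θ z b k) y = pd a (pd b fun z => θ z k) y -
      ∑ p, pd a (christoffel G p b k) y * θ y p -
      ∑ p, christoffel G p b k y * pd a (fun z => θ z p) y := by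
    unfold covDeriv
    rw [pd_sub a (differentiableAt_of_contDiffOn hG.isOpen (contDiffOn_pd hG.isOpen (hθ k) b) hy)
        (DifferentiableAt.fun_sum fun p _ => (hG.differentiableAt_christoffel hy p b k).fun_mul (hd p)),
      pd_sum _ _ fun p _ => (hG.differentiableAt_christoffel hy p b k).fun_mul (hd p)]
    simp only [pd_mul a (hG.differentiableAt_christoffel hy _ b k) (hd _), Finset.sum_add_distrib]
    ring
  -- Torsion-freeness: the corrections on the index of the inner derivative agree in the two orders
  -- and cancel.
  have h1 : ∑ p, christoffel G p i m y * covDeriv G θ y p k =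
      ∑ p, christoffel G p m i y * covDeriv G θ y p k :=
    Finset.sum_congr rfl fun p _ => by rw [hG.christoffel_symm hy]
  have h2 (a b : Fin n) : ∑ p, christoffel G p a k y * covDeriv G θ y b p =
      ∑ p, christoffel G p a k y * pd b (fun z => θ z p) y -
      ∑ q, (∑ p, christoffel G q b p y * christoffel G p a k y) * θ y q := by
    simp only [covDeriv, mul_sub, Finset.sum_sub_distrib, Finset.mul_sum, Finset.sum_mul]
    congr 1
    rw [Finset.sum_comm]
    exact Finset.sum_congr rfl fun _ _ => Finset.sum_congr rfl fun _ _ => by ring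
  simp only [covDeriv₂, h, h1, h2, riemann, pd_comm hG.isOpen (hθ k) hy i m, add_mul, sub_mul,
    Finset.sum_add_distrib, Finset.sum_sub_distrib]
  ring

/-- The curvature tensor with its first two indices raised is antisymmetric in them. -/
theorem riemann_antisymm (hy : y ∈ U) (j k i m : Fin n) :
    ∑ p, riemann G y j p i m * gInv G y p k = -∑ p, riemann G y k p i m * gInv G y p j := by
  have hΓ := hG.differentiableAt_christoffel hy
  have hg := hG.differentiableAt_gInv hy
  -- Differentiating `∇ g⁻¹ = 0` once more. The last two sums are exchanged by `a ↔ b`, so they drop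
  -- out when mixed partials are equated; the remaining terms assemble into the two curvature sums.
  have h (a b : Fin n) : pd a (pd b fun z => gInv G z j k) y =
      (-(∑ p, pd a (christoffel G j b p) y * gInv G y p k) +
        ∑ p, (∑ q, christoffel G j b q y * christoffel G q a p y) * gInv G y p k) +
      (-(∑ p, pd a (christoffel G k b p) y * gInv G y p j) +
        ∑ p, (∑ q, christoffel G k b q y * christoffel G q a p y) * gInv G y p j) +
      (∑ p, ∑ q, christoffel G j b p y * christoffel G k a q y * gInv G y p q +
       ∑ p, ∑ q, christoffel G j a p y * christoffel G k b q y * gInv G y p q) := by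
    have e1 : pd a (pd b fun z => gInv G z j k) y = pd a (fun z =>
        -(∑ p, christoffel G j b p z * gInv G z p k) -
          ∑ p, christoffel G k b p z * gInv G z j p) y :=
      pd_congr hG.isOpen (fun z hz => hG.pd_gInv hz b j k) hy a
    have c1 : ∑ p, christoffel G j b p y * ∑ q, christoffel G p a q y * gInv G y q k =
        ∑ p, (∑ q, christoffel G j b q y * christoffel G q a p y) * gInv G y p k := by
      simp only [Finset.mul_sum, Finset.sum_mul]
      rw [Finset.sum_comm]
      exact Finset.sum_congr rfl fun _ _ => Finset.sum_congr rfl fun _ _ => by ring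
    have c2 : ∑ p, christoffel G k b p y * ∑ q, christoffel G p a q y * gInv G y j q =
        ∑ p, (∑ q, christoffel G k b q y * christoffel G q a p y) * gInv G y p j := by
      simp only [Finset.mul_sum, Finset.sum_mul]
      rw [Finset.sum_comm]
      refine Finset.sum_congr rfl fun _ _ => Finset.sum_congr rfl fun _ _ => ?_
      rw [hG.gInv_symm hy j]
      ring
    have c3 : ∑ p, christoffel G k b p y * ∑ q, christoffel G j a q y * gInv G y q p =
        ∑ p, ∑ q, christoffel G j a p y * christoffel G k b q y * gInv G y p q := by
      simp only [Finset.mul_sum]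
      rw [Finset.sum_comm]
      exact Finset.sum_congr rfl fun _ _ => Finset.sum_congr rfl fun _ _ => by ring
    have c4 : ∑ p, christoffel G j b p y * ∑ q, christoffel G k a q y * gInv G y p q =
        ∑ p, ∑ q, christoffel G j b p y * christoffel G k a q y * gInv G y p q := by
      simp only [Finset.mul_sum, mul_assoc]
    have c5 : ∑ p, pd a (christoffel G k b p) y * gInv G y j p =
        ∑ p, pd a (christoffel G k b p) y * gInv G y p j :=
      Finset.sum_congr rfl fun p _ => by rw [hG.gInv_symm hy]
    rw [e1, pd_sub a (DifferentiableAt.fun_sum fun p _ => (hΓ _ _ _).fun_mul (hg _ _)).fun_neg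
      (DifferentiableAt.fun_sum fun p _ => (hΓ _ _ _).fun_mul (hg _ _)), pd_neg,
      pd_sum _ _ fun p _ => (hΓ _ _ _).fun_mul (hg _ _),
      pd_sum _ _ fun p _ => (hΓ _ _ _).fun_mul (hg _ _)]
    simp only [pd_mul a (hΓ _ _ _) (hg _ _), hG.pd_gInv hy, mul_sub, mul_neg,
      Finset.sum_add_distrib, Finset.sum_sub_distrib, Finset.sum_neg_distrib, c1, c2, c3, c4, c5]
    ring
  have hc := pd_comm hG.isOpen (hG.contDiffOn_gInv j k) hy i m
  rw [h, h] at hc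
  simp only [riemann, add_mul, sub_mul, Finset.sum_add_distrib, Finset.sum_sub_distrib]
  linarith

end IsLocalMetric
end Bochner

/-! ### The weighted Bochner formula and its shift. -/

section Bochner
variable {n : ℕ} {U : Set (EuclideanSpace ℝ (Fin n))} {y : EuclideanSpace ℝ (Fin n)}
  {G : EuclideanSpace ℝ (Fin n) → Matrix (Fin n) (Fin n) ℝ}
  {Ψ : EuclideanSpace ℝ (Fin n) → ℝ}
  {u v θ : EuclideanSpace ℝ (Fin n) → Fin n → ℝ}

theorem contDiffOn_dForm (hU : IsOpen U) (hθ : ∀ i, ContDiffOn ℝ ∞ (fun y => θ y i) U)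
    (i j : Fin n) : ContDiffOn ℝ ∞ (fun y => dForm θ y i j) U :=
  (contDiffOn_pd hU (hθ j) i).sub (contDiffOn_pd hU (hθ i) j)

theorem inner1_add_right (a b c : Fin n → ℝ) :
    inner1 G y a (fun i => b i + c i) = inner1 G y a b + inner1 G y a c := by
  simp only [inner1, mul_add, Finset.sum_add_distrib]

theorem sum_comm_right {ι : Type*} [Fintype ι] (F : ι → ι → ι → ℝ) :
    ∑ i, ∑ k, ∑ m, F i k m = ∑ m, ∑ i, ∑ k, F i k m := by
  rw [Finset.sum_comm (s := Finset.univ) (t := Finset.univ) (f := fun m i => ∑ k, F i k m)]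
  exact Finset.sum_congr rfl fun i _ => Finset.sum_comm

theorem covDeriv₂_eq (T : EuclideanSpace ℝ (Fin n) → Fin n → Fin n → ℝ) (l k i : Fin n) :
    covDeriv₂ G T y l k i =
      covDeriv G (fun z => T z k) y l i - ∑ p, christoffel G p l k y * T y p i := by
  unfold covDeriv₂ covDeriv
  ring

theorem covDeriv₂_mul (hu : ∀ i, DifferentiableAt ℝ (fun z => u z i) y)
    (hv : ∀ i, DifferentiableAt ℝ (fun z => v z i) y) (k i j : Fin n) :
    covDeriv₂ G (fun z i j => u z i * v z j) y k i j =
      covDeriv G u y k i * v y j + u y i * covDeriv G v y k j := by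
  simp only [covDeriv₂, covDeriv, pd_mul k (hu i) (hv j), sub_mul, mul_sub, Finset.sum_mul,
    Finset.mul_sum, mul_assoc, mul_left_comm]
  ring

namespace IsLocalMetric

variable (hG : IsLocalMetric U G)
include hG

theorem pd_inner1 (hy : y ∈ U) (hu : ∀ i, DifferentiableAt ℝ (fun z => u z i) y)
    (hv : ∀ i, DifferentiableAt ℝ (fun z => v z i) y) (k : Fin n) :
    pd k (fun z => inner1 G z (u z) (v z)) y =
      inner1 G y (covDeriv G u y k) (v y) + inner1 G y (u y) (covDeriv G v y k) := by
  simp only [inner1, mul_assoc]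
  rw [hG.pd_trace hy (T := fun z i j => u z i * v z j) fun i j => (hu i).fun_mul (hv j)]
  simp only [covDeriv₂_mul hu hv, mul_add, Finset.sum_add_distrib]

theorem pd_inner1_self (hy : y ∈ U) (hu : ∀ i, ContDiffOn ℝ ∞ (fun z => u z i) U) (k : Fin n) :
    pd k (fun z => inner1 G z (u z) (u z)) y = 2 * inner1 G y (covDeriv G u y k) (u y) := by
  have hd := fun p => differentiableAt_of_contDiffOn hG.isOpen (hu p) hy
  rw [hG.pd_inner1 hy hd hd, hG.inner1_comm hy (u y)]
  ring

theorem contDiffOn_inner1 (hu : ∀ i, ContDiffOn ℝ ∞ (fun z => u z i) U)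
    (hv : ∀ i, ContDiffOn ℝ ∞ (fun z => v z i) U) :
    ContDiffOn ℝ ∞ (fun z => inner1 G z (u z) (v z)) U :=
  ContDiffOn.sum fun i _ => ContDiffOn.sum fun j _ => ((hG.contDiffOn_gInv i j).mul (hu i)).mul (hv j)

theorem dFun_half_normSq (hθ : ∀ i, ContDiffOn ℝ ∞ (fun z => θ z i) U) :
    ∀ y ∈ U, ∀ k, dFun (fun z => inner1 G z (θ z) (θ z) / 2) y k =
      inner1 G y (covDeriv G θ y k) (θ y) := fun y hy k => by
  have hd := differentiableAt_of_contDiffOn hG.isOpen (hG.contDiffOn_inner1 hθ hθ) hy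
  simp only [dFun, div_eq_inv_mul]
  rw [pd_const_mul _ _ hd, hG.pd_inner1_self hy hθ]
  ring

/-- `∇_l ∇_k (|θ|²/2) = ∇_l ∇_k θ · θ + ∇_k θ · ∇_l θ`. -/
theorem hess_half_normSq (hθ : ∀ i, ContDiffOn ℝ ∞ (fun z => θ z i) U) (hy : y ∈ U)
    (l k : Fin n) :
    covDeriv G (dFun fun z => inner1 G z (θ z) (θ z) / 2) y l k =
      inner1 G y (covDeriv₂ G (covDeriv G θ) y l k) (θ y) +
        inner1 G y (covDeriv G θ y k) (covDeriv G θ y l) := by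
  have hdA := fun i j => differentiableAt_of_contDiffOn hG.isOpen (hG.contDiffOn_covDeriv hθ i j) hy
  have hd := fun i => differentiableAt_of_contDiffOn hG.isOpen (hθ i) hy
  have h : inner1 G y (covDeriv₂ G (covDeriv G θ) y l k) (θ y) =
      inner1 G y (covDeriv G (fun z => covDeriv G θ z k) y l) (θ y) -
      ∑ p, christoffel G p l k y * inner1 G y (covDeriv G θ y p) (θ y) := by
    simp only [inner1_eq_sum_mul_sharp, covDeriv₂_eq, sub_mul, Finset.sum_sub_distrib,
      Finset.sum_mul, Finset.mul_sum, mul_assoc]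
    congr 1
    exact Finset.sum_comm
  rw [covDeriv, pd_congr hG.isOpen (fun z hz => hG.dFun_half_normSq hθ z hz k) hy,
    Finset.sum_congr rfl fun p _ => by rw [hG.dFun_half_normSq hθ y hy p],
    hG.pd_inner1 hy (u := fun z => covDeriv G θ z k) (hdA k) hd, h]
  ring

theorem laplaceBeltrami_half_normSq (hθ : ∀ i, ContDiffOn ℝ ∞ (fun z => θ z i) U) (hy : y ∈ U) :
    laplaceBeltrami G (fun z => inner1 G z (θ z) (θ z) / 2) y =
      ∑ m, sharp G y (θ y) m * ∑ i, ∑ k, gInv G y i k * covDeriv₂ G (covDeriv G θ) y i k m +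
        innerTensor G y (covDeriv G θ y) (covDeriv G θ y) := by
  simp only [laplaceBeltrami, divForm, hG.hess_half_normSq hθ hy, mul_add, Finset.sum_add_distrib]
  congr 1
  · simp only [inner1_eq_sum_mul_sharp, Finset.mul_sum]
    rw [sum_comm_right]
    exact Finset.sum_congr rfl fun _ _ => Finset.sum_congr rfl fun _ _ =>
      Finset.sum_congr rfl fun _ _ => by ring
  · unfold innerTensor
    refine Finset.sum_congr rfl fun i _ => ?_
    rw [Finset.sum_comm]
    refine Finset.sum_congr rfl fun k _ => ?_
    rw [hG.inner1_comm hy]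
    simp only [inner1, Finset.mul_sum]
    exact Finset.sum_congr rfl fun _ _ => Finset.sum_congr rfl fun _ _ => by ring

theorem inner1_dFun_half_normSq (hθ : ∀ i, ContDiffOn ℝ ∞ (fun z => θ z i) U) (hy : y ∈ U)
    (a : Fin n → ℝ) :
    inner1 G y a (dFun (fun z => inner1 G z (θ z) (θ z) / 2) y) =
      ∑ m, sharp G y (θ y) m * ∑ i, ∑ k, gInv G y i k * (a i * covDeriv G θ y k m) := by
  rw [show dFun (fun z => inner1 G z (θ z) (θ z) / 2) y =
    fun k => ∑ m, covDeriv G θ y k m * sharp G y (θ y) m from funext fun k => by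
      rw [hG.dFun_half_normSq hθ y hy, inner1_eq_sum_mul_sharp]]
  simp only [inner1, Finset.mul_sum]
  rw [sum_comm_right]
  exact Finset.sum_congr rfl fun _ _ => Finset.sum_congr rfl fun _ _ =>
    Finset.sum_congr rfl fun _ _ => by ring

theorem dFun_wDivForm (hθ : ∀ i, ContDiffOn ℝ ∞ (fun z => θ z i) U) (hΨ : ContDiffOn ℝ ∞ Ψ U)
    (hy : y ∈ U) (m : Fin n) :
    dFun (wDivForm G Ψ θ) y m =
      ∑ i, ∑ k, gInv G y i k * covDeriv₂ G (covDeriv G θ) y m i k -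
      ∑ i, hess G Ψ y m i * sharp G y (θ y) i -
      ∑ i, ∑ k, gInv G y i k * (dFun Ψ y i * covDeriv G θ y m k) := by
  have hA := hG.contDiffOn_covDeriv hθ
  have hdA := fun i j => differentiableAt_of_contDiffOn hG.isOpen (hA i j) hy
  have hdΨ := contDiffOn_pd hG.isOpen hΨ
  have h1 : pd m (wDivForm G Ψ θ) y = pd m (divForm G θ) y -
      pd m (fun z => inner1 G z (dFun Ψ z) (θ z)) y :=
    pd_sub m (differentiableAt_of_contDiffOn hG.isOpen (ContDiffOn.sum fun i _ =>
      ContDiffOn.sum fun j _ => (hG.contDiffOn_gInv i j).mul (hA i j)) hy)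
      (differentiableAt_of_contDiffOn hG.isOpen (hG.contDiffOn_inner1 hdΨ hθ) hy)
  have h2 : pd m (divForm G θ) y = _ := hG.pd_trace hy hdA m
  rw [dFun, h1, h2, hG.pd_inner1 hy (u := dFun Ψ)
    (fun i => differentiableAt_of_contDiffOn hG.isOpen (hdΨ i) hy)
    (fun i => differentiableAt_of_contDiffOn hG.isOpen (hθ i) hy), inner1_eq_sum_mul_sharp,
    sub_sub]
  simp only [inner1, hess, mul_assoc]

/-- Because the connection is torsion-free, `dθ` is the antisymmetrisation of `∇θ` on `U`;
substituting this in `codiffVec_eq` expresses `δ_Ψ dθ` by second covariant derivatives. -/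
theorem codiffVec_dForm (hθ : ∀ i, ContDiffOn ℝ ∞ (fun z => θ z i) U) (hΨ : ContDiffOn ℝ ∞ Ψ U)
    (hy : y ∈ U) :
    ∑ j, θ y j * codiffVec G Ψ (dForm θ) y j =
      ∑ m, sharp G y (θ y) m * ∑ i, ∑ k, gInv G y i k *
        (covDeriv₂ G (covDeriv G θ) y i k m - covDeriv₂ G (covDeriv G θ) y i m k -
          dFun Ψ y i * (covDeriv G θ y k m - covDeriv G θ y m k)) := by
  have hdA := fun i j =>
    differentiableAt_of_contDiffOn hG.isOpen (hG.contDiffOn_covDeriv hθ i j) hy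
  have h1 : ∀ z ∈ U, ∀ k m, dForm θ z k m = covDeriv G θ z k m - covDeriv G θ z m k :=
    fun z hz k m => by
      simp only [dForm, covDeriv, hG.christoffel_symm hz _ k m]
      ring
  have h2 (i k m : Fin n) : covDeriv₂ G (dForm θ) y i k m =
      covDeriv₂ G (covDeriv G θ) y i k m - covDeriv₂ G (covDeriv G θ) y i m k := by
    simp only [covDeriv₂]
    rw [pd_congr hG.isOpen (fun z hz => h1 z hz k m) hy, pd_sub i (hdA k m) (hdA m k)]
    simp only [h1 y hy, mul_sub, Finset.sum_sub_distrib]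
    ring
  simp only [hG.codiffVec_eq hΨ hy (contDiffOn_dForm hG.isOpen hθ)
    (fun z => dForm_antisymm (y := z) θ), h2, h1 y hy]
  simp only [sharp, Finset.mul_sum, Finset.sum_mul]
  rw [Finset.sum_congr rfl fun j _ => sum_comm_right _, Finset.sum_comm]
  refine Finset.sum_congr rfl fun m _ => ?_
  rw [← sum_comm_right]
  refine Finset.sum_congr rfl fun _ _ => Finset.sum_congr rfl fun _ _ =>
    Finset.sum_congr rfl fun _ _ => ?_
  rw [hG.gInv_symm hy m, dFun]
  ring

/-- The Ricci identity gives `-g^ik R^q_kim θ_q`. Antisymmetry of the raised curvature exchanges `q`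
and `i`, which removes the sign and turns the sum over `i` into the Ricci contraction. -/
theorem sum_commutator (hθ : ∀ i, ContDiffOn ℝ ∞ (fun z => θ z i) U) (hy : y ∈ U) :
    ∑ m, sharp G y (θ y) m * ∑ i, ∑ k, gInv G y i k *
      (covDeriv₂ G (covDeriv G θ) y i m k - covDeriv₂ G (covDeriv G θ) y m i k) =
    ∑ m, ∑ k, ricci G y m k * sharp G y (θ y) m * sharp G y (θ y) k := by
  have h (m i : Fin n) : ∑ k, gInv G y i k * ∑ q, riemann G y q k i m * θ y q =
      -∑ k, riemann G y i k i m * sharp G y (θ y) k := by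
    have h1 : ∑ k, gInv G y i k * ∑ q, riemann G y q k i m * θ y q =
        ∑ q, (∑ k, riemann G y q k i m * gInv G y k i) * θ y q := by
      simp only [Finset.mul_sum, Finset.sum_mul]
      rw [Finset.sum_comm]
      refine Finset.sum_congr rfl fun _ _ => Finset.sum_congr rfl fun _ _ => ?_
      rw [hG.gInv_symm hy i]
      ring
    rw [h1]
    simp only [hG.riemann_antisymm hy _ i, sharp, neg_mul, Finset.sum_neg_distrib, Finset.sum_mul,
      Finset.mul_sum]
    rw [Finset.sum_comm]
    simp only [mul_assoc]
  simp only [hG.covDeriv₂_covDeriv_sub hθ hy, mul_neg, Finset.sum_neg_distrib, h, neg_neg]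
  simp only [ricci_eq_sum_riemann, Finset.mul_sum, Finset.sum_mul]
  refine Finset.sum_congr rfl fun m _ => ?_
  rw [Finset.sum_comm]
  exact Finset.sum_congr rfl fun _ _ => Finset.sum_congr rfl fun _ _ => by ring

/-- The Bochner formula for 1-forms on a weighted manifold. -/
theorem bochner (hθ : ∀ i, ContDiffOn ℝ ∞ (fun z => θ z i) U) (hΨ : ContDiffOn ℝ ∞ Ψ U)
    (hy : y ∈ U) :
    generator G Ψ (fun z => inner1 G z (θ z) (θ z) / 2) y -
      inner1 G y (θ y) (hodgeDeRham U G Ψ θ y) =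
    innerTensor G y (covDeriv G θ y) (covDeriv G θ y) +
      bakryEmery G Ψ y (sharp G y (θ y)) (sharp G y (θ y)) := by
  have hD := contDiffOn_dForm hG.isOpen hθ
  have hanti := fun z => dForm_antisymm (y := z) θ
  -- The operator uses an arbitrary choice of codifferential; uniqueness replaces its value at `y`
  -- by the explicit formula.
  have hcod : weightedCodifferential U G Ψ (dForm θ) y = codiff G Ψ (dForm θ) y :=
    hG.eqOn_of_isWeightedCodifferential hΨ
      (hG.isWeightedCodifferential_weightedCodifferential hΨ hD hanti)
      (hG.isWeightedCodifferential_codiff hΨ hD hanti) hy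
  have hH : inner1 G y (θ y) (hodgeDeRham U G Ψ θ y) =
      ∑ m, sharp G y (θ y) m * dFun (wDivForm G Ψ θ) y m +
        ∑ j, θ y j * codiffVec G Ψ (dForm θ) y j := by
    rw [← hG.inner1_eq_sum_sharp_mul hy, ← hG.inner1_codiff hy, ← hcod, ← inner1_add_right]
    rfl
  have hB : bakryEmery G Ψ y (sharp G y (θ y)) (sharp G y (θ y)) =
      ∑ m, ∑ k, ricci G y m k * sharp G y (θ y) m * sharp G y (θ y) k +
        ∑ m, sharp G y (θ y) m * ∑ i, hess G Ψ y m i * sharp G y (θ y) i := by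
    simp only [bakryEmery, add_mul, Finset.sum_add_distrib, Finset.mul_sum]
    congr 1
    exact Finset.sum_congr rfl fun _ _ => Finset.sum_congr rfl fun _ _ => by ring
  rw [generator, hG.laplaceBeltrami_half_normSq hθ hy, hG.inner1_dFun_half_normSq hθ hy, hH,
    hG.codiffVec_dForm hθ hΨ hy, hB, ← hG.sum_commutator hθ hy]
  simp only [hG.dFun_wDivForm hθ hΨ hy, mul_sub, Finset.sum_sub_distrib]
  ring

/-- The Bochner formula with the covariant derivative shifted by `2b α ⊗ θ`. -/
theorem bochner_shift (hθ : ∀ i, ContDiffOn ℝ ∞ (fun z => θ z i) U) (hΨ : ContDiffOn ℝ ∞ Ψ U)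
    (hy : y ∈ U) (a : Fin n → ℝ) (b : ℝ) :
    generator G Ψ (fun z => inner1 G z (θ z) (θ z) / 2) y
        - inner1 G y (θ y) (hodgeDeRham U G Ψ θ y)
        + 2 * b * inner1 G y a (dFun (fun z => inner1 G z (θ z) (θ z)) y)
        + 4 * b ^ 2 * inner1 G y a a * inner1 G y (θ y) (θ y)
      = innerTensor G y (fun i j => covDeriv G θ y i j + 2 * b * a i * θ y j)
          (fun i j => covDeriv G θ y i j + 2 * b * a i * θ y j)
        + bakryEmery G Ψ y (sharp G y (θ y)) (sharp G y (θ y)) := by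
  have h1 : dFun (fun z => inner1 G z (θ z) (θ z)) y =
      fun k => 2 * inner1 G y (covDeriv G θ y k) (θ y) :=
    funext fun k => hG.pd_inner1_self hy hθ k
  -- The cross term: multiplied by `2b`, it is the `4b ⟨α ⊗ θ, ∇θ⟩` of the expanded square.
  have h2 : inner1 G y a (fun k => 2 * inner1 G y (covDeriv G θ y k) (θ y)) =
      2 * innerTensor G y (fun i j => a i * θ y j) (covDeriv G θ y) := by
    rw [hG.innerTensor_tmul hy]
    simp only [inner1_eq_sum_mul_sharp (covDeriv G θ y _)]
    simp only [inner1, Finset.mul_sum]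
    exact Finset.sum_congr rfl fun _ _ => Finset.sum_congr rfl fun _ _ =>
      Finset.sum_congr rfl fun _ _ => by ring
  have h3 : innerTensor G y (fun i j => a i * θ y j) (fun i j => a i * θ y j) =
      inner1 G y a a * inner1 G y (θ y) (θ y) := by
    rw [hG.innerTensor_tmul hy]
    simp only [inner1_eq_sum_mul_sharp (θ y), mul_assoc, ← Finset.mul_sum]
    simp only [inner1, Finset.sum_mul, mul_assoc]
  have h4 : (fun i j => covDeriv G θ y i j + 2 * b * a i * θ y j) =
      fun i j => covDeriv G θ y i j + 2 * b * (a i * θ y j) := by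
    simp only [mul_assoc]
  have h5 : innerTensor G y (covDeriv G θ y) (fun i j => 2 * b * (a i * θ y j)) =
      2 * b * innerTensor G y (fun i j => a i * θ y j) (covDeriv G θ y) := by
    rw [hG.innerTensor_comm hy, innerTensor_smul_left]
  rw [hG.bochner hθ hΨ hy, h1, h2, h4, innerTensor_add_add, h5, innerTensor_smul_left,
    innerTensor_smul_left, hG.innerTensor_comm hy (fun i j => a i * θ y j) (fun i j => 2 * b * _),
    innerTensor_smul_left, h3]
  ring

end IsLocalMetric
end Bochner

end RefinedBLW

end

/-! ### The local results applied to the chart expressions on the manifold. -/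

open RefinedBLW in
theorem proposition3p1 {n : ℕ} {M : Type*} [TopologicalSpace M]
    [ChartedSpace (EuclideanSpace ℝ (Fin n)) M] [IsManifold (𝓡 n) ∞ M]
    [T2Space M] [CompactSpace M] [ConnectedSpace M]
    (g : SmoothMetric n M) (Ψ : M → ℝ) (hΨ : ContMDiff (𝓡 n) 𝓘(ℝ) ∞ Ψ)
    (α η : OneForm n M) (b : ℝ)
    (c : OpenPartialHomeomorph M (EuclideanSpace ℝ (Fin n)))
    (hc : c ∈ IsManifold.maximalAtlas (𝓡 n) ∞ M) :
    let G := metricInChart g c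
    let ψ := funInChart Ψ c
    let a := formInChart α c
    let e := formInChart η c
    let normSq : EuclideanSpace ℝ (Fin n) → ℝ := fun y => inner1 G y (e y) (e y)
    -- the codifferential of `dη`, hence the Hodge-de Rham operator, is well defined
    IsWeightedCodifferential c.target G ψ (dForm e)
        (weightedCodifferential c.target G ψ (dForm e)) ∧
    (∀ ξ, IsWeightedCodifferential c.target G ψ (dForm e) ξ →
      Set.EqOn ξ (weightedCodifferential c.target G ψ (dForm e)) c.target) ∧
    -- the pointwise identity, at the point of `M` with coordinates `y`
    ∀ y ∈ c.target,
      generator G ψ (fun z => normSq z / 2) y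
          - inner1 G y (e y) (hodgeDeRham c.target G ψ e y)
          + 2 * b * inner1 G y (a y) (dFun normSq y)
          + 4 * b ^ 2 * inner1 G y (a y) (a y) * normSq y
        = innerTensor G y (fun i j => covDeriv G e y i j + 2 * b * a y i * e y j)
            (fun i j => covDeriv G e y i j + 2 * b * a y i * e y j)
          + bakryEmery G ψ y (sharp G y (e y)) (sharp G y (e y)) := by
  intro G ψ a e normSq
  have hG : IsLocalMetric c.target G :=
    ⟨c.open_target, contDiffOn_metricInChart g hc, fun _ hy => posDef_metricInChart g hc hy⟩
  have hψ : ContDiffOn ℝ ∞ ψ c.target := contDiffOn_funInChart hΨ hc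
  have he : ∀ i, ContDiffOn ℝ ∞ (fun y => e y i) c.target := contDiffOn_formInChart η hc
  have hcod := hG.isWeightedCodifferential_weightedCodifferential hψ
    (contDiffOn_dForm hG.isOpen he) fun z => dForm_antisymm (y := z) e
  exact ⟨hcod, fun ξ hξ => hG.eqOn_of_isWeightedCodifferential hψ hξ hcod,
    fun y hy => hG.bochner_shift he hψ hy (a y) b⟩
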